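/- Let $\Delta^+=\{\zeta\in\mathbb C:|\zeta|<1,\ \operatorname{Im}\zeta\ge 0\}$ be the half-disk with edge $(-1,1)$, and let $u_1,u_2:\Delta^+\to\mathbb C^2$ be $C^\infty$ embeddings (smooth up to the edge), holomorphic in the interior of $\Delta^+$, with $u_1(0)=u_2(0)=p$. Put $C_k=u_k(\Delta^+)$, oriented by $\Delta^+$. A *graph form* of $(C_1,C_2)$ at $p$ is obtained as follows. Near $p$, replace each $C_k$ by a half-disk $C_k'$ inside a smooth extension of $C_k$ beyond its edge, such that the edge of $C_k'$ passes through $p$ and has there the same oriented direction, and the same interior side, as the edge of $C_k$ (for instance, shrink $C_k$). Then apply an orientation-preserving local diffeomorphism of $\mathbb R^4=\mathbb C^2$ that sends $p$ to $0$, that sends $C_1'$ near $p$ to the flat half-disk $\{(z,0):\operatorname{Im}z\ge 0\}$, and that sends $C_2'$ to a graph $\{(z,\phi(z))\}$ over $\{\operatorname{Im}z\ge 0\}$ (the half-disks touch) or over $\{\operatorname{Im}z\le 0\}$ (they meet), orientations being respected. The *order of tangency* of $C_1$ and $C_2$ at $p$ is $d$ if in some graph form $\phi(x)=r x^d+O(x^{d+1})$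 for real $x\to 0$, with $r\in\mathbb C$, $r\neq 0$. For half-disks tangent at $p$ (equal tangent planes, and edges with collinear tangent vectors) a finite order of tangency is at least $2$; the value $d=1$ occurs for transverse half-disks. The *index of intersection* of $C_1$ and $C_2$ at $p$ is defined from any graph form in which $\phi$ is real on the real axis near $0$. Extend the flat half-disk to the flat disk, and extend $\phi$ to a neighbourhood of $0$ in $\mathbb C$ by $\tilde\phi(z)=\overline{\phi(\bar z)}$. The index is the intersection index at the origin of the plane $\mathbb C\times\{0\}$ with the graph of $\tilde\phi$, which meet only at the origin; that is, the algebraic number of points of intersection of $\mathbb C\times\{0\}$ with any sufficiently small smooth transverse perturbation of that graph near the origin. **Theorem.** Suppose that the order of tangency of $C_1$ and $C_2$ at $p$ is finite and equal to $d$. Then: (i) the index of intersection of $C_1$ and $C_2$ at $p$ is well defined (a graph form as required exists, and all of them give the same number) and equals $d$; in particular it is positive; (ii) the index equals $1$ if and only if $C_1$ and $C_2$ intersect transversely at $p$, i.e. $T_pC_1+T_pC_2=\mathbb C^2$. -/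

import Mathlib

open Filter Topology
open scoped ContDiff ComplexConjugate

noncomputable section

namespace HalfDisk

/-- The half-disk `Δ⁺ = {ζ : |ζ| < 1, Im ζ ≥ 0}`, with edge the interval `(-1, 1)`. -/
def upperHalfDisk : Set ℂ := {ζ | ‖ζ‖ < 1 ∧ 0 ≤ ζ.im}

/-- `f` is (real) `C^∞` on some neighbourhood of `x`. -/
def SmoothNear {E F : Type*} [NormedAddCommGroup E] [NormedSpace ℝ E]
    [NormedAddCommGroup F] [NormedSpace ℝ F] (f : E → F) (x : E) : Prop :=
  ∀ᶠ y in 𝓝 x, ContDiffAt ℝ ∞ f y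

/-- `v` is a `C^∞` extension of `u|Δ⁺` to a full neighbourhood of the point `ζ`. -/
def IsSmoothExtensionAt (u v : ℂ → ℂ × ℂ) (ζ : ℂ) : Prop :=
  SmoothNear v ζ ∧ ∀ᶠ z in 𝓝[upperHalfDisk] ζ, v z = u z

/-- `u` restricts to an embedding `Δ⁺ → ℂ²`, smooth up to the edge and holomorphic in the
interior. Values of `u` outside `Δ⁺` are irrelevant. -/
structure IsAnalyticHalfDisk (u : ℂ → ℂ × ℂ) : Prop where
  smooth : ∀ ζ ∈ upperHalfDisk, ∃ v, IsSmoothExtensionAt u v ζ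
  immersion : ∀ ζ ∈ upperHalfDisk, Function.Injective (fderivWithin ℝ u upperHalfDisk ζ)
  embedding : IsEmbedding (upperHalfDisk.domRestrict u)
  holomorphic : DifferentiableOn ℂ u (interior upperHalfDisk)

/-- The tangent plane at `u 0` of the surface with boundary `u(Δ⁺)`. -/
def tangentPlane (u : ℂ → ℂ × ℂ) : Submodule ℝ (ℂ × ℂ) :=
  LinearMap.range (fderivWithin ℝ u upperHalfDisk 0).toLinearMap

/-- The two half-disks are transverse at `u₁ 0 = u₂ 0`. -/
def IntersectTransversely (u₁ u₂ : ℂ → ℂ × ℂ) : Prop :=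
  tangentPlane u₁ ⊔ tangentPlane u₂ = ⊤

/-- An orientation preserving local diffeomorphism `η` of the plane of parameters at `0`, with
`η 0 = 0`, which keeps the direction of the edge and the side of the interior at `0`.
It need not preserve the edge itself. -/
structure IsEdgeChange (η : ℂ → ℂ) : Prop where
  smooth : SmoothNear η 0
  zero : η 0 = 0
  tangent_re : 0 < (fderiv ℝ η 0 1).re
  tangent_im : (fderiv ℝ η 0 1).im = 0
  inward : 0 < (fderiv ℝ η 0 Complex.I).im

/-- After shrinking the half-disks, or moving their edges inside smooth extensions of them
(`z ↦ vₖ (ηₖ z)`, `Im z ≥ 0`, is a parametrisation of the new half-disk, whose edge is tangent at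
`0` to the old one), there is an orientation preserving local diffeomorphism `Ψ` of `ℂ² = ℝ⁴`
taking, near the common point, the first half-disk to the flat one `{(z, 0) : Im z ≥ 0}` and the
second to the graph of `φ` over the half-disk `{Im z ≥ 0}` (`σ = 1`, the half-disks *touch*)
or `{Im z ≤ 0}` (`σ = -1`, they *meet*), with the orientations coming from `z`. -/
def IsGraphForm (u₁ u₂ : ℂ → ℂ × ℂ) (σ : ℝ) (φ : ℂ → ℂ) : Prop :=
  (σ = 1 ∨ σ = -1) ∧
  ∃ (v₁ v₂ : ℂ → ℂ × ℂ) (η₁ η₂ : ℂ → ℂ) (Ψ : ℂ × ℂ → ℂ × ℂ),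
    IsSmoothExtensionAt u₁ v₁ 0 ∧ IsSmoothExtensionAt u₂ v₂ 0 ∧
    IsEdgeChange η₁ ∧ IsEdgeChange η₂ ∧
    SmoothNear Ψ (u₁ 0) ∧ Ψ (u₁ 0) = 0 ∧ 0 < (fderiv ℝ Ψ (u₁ 0)).det ∧
    ∀ᶠ z in 𝓝[{z : ℂ | 0 ≤ z.im}] (0 : ℂ),
      Ψ (v₁ (η₁ z)) = (z, 0) ∧ Ψ (v₂ (η₂ z)) = (σ * z, φ (σ * z))

/-- The order of tangency is `d`: in a graph form, `φ(x) = r x^d + O(x^(d+1))`, `r ≠ 0`, along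
the edge. -/
def HasTangencyOrder (u₁ u₂ : ℂ → ℂ × ℂ) (d : ℕ) : Prop :=
  ∃ (σ : ℝ) (φ : ℂ → ℂ), IsGraphForm u₁ u₂ σ φ ∧
    ∃ r : ℂ, r ≠ 0 ∧
      (fun x : ℝ => φ x - r * (x : ℂ) ^ d) =O[𝓝 0] (fun x : ℝ => x ^ (d + 1))

/-- The extension by reflection `φ̃(z) = conj (φ (conj z))` of a function `φ` given on the
half-plane `σ Im z ≥ 0` and real on the edge. -/
def reflect (σ : ℝ) (φ : ℂ → ℂ) (z : ℂ) : ℂ :=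
  open Classical in if 0 ≤ σ * z.im then φ z else conj (φ (conj z))

/-- The determinant of `T(ℂ × 0) ⊕ T_w → ℂ²`, where `T_w` is the tangent of the parametrised
surface `G` at `G w`. It is nonzero iff `G` is transverse to `ℂ × 0` there, and its sign is then
the sign of the intersection. -/
def crossingDet (G : ℂ → ℂ × ℂ) (w : ℂ) : ℝ :=
  LinearMap.det ((LinearMap.inl ℝ ℂ ℂ).coprod (fderiv ℝ G w).toLinearMap)

/-- The parameters, over the closed disk of radius `r`, of the points of intersection of the
surface `G` with `ℂ × 0`. -/
def crossings (G : ℂ → ℂ × ℂ) (r : ℝ) : Set ℂ :=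
  {w | w ∈ Metric.closedBall (0 : ℂ) r ∧ (G w).2 = 0}

/-- `G` is a smooth `δ`-perturbation of the graph of `f` over the closed disk of radius `r`,
transverse to `ℂ × 0`. (It then has finitely many crossings.) -/
def IsTransversePerturbation (f : ℂ → ℂ) (r δ : ℝ) (G : ℂ → ℂ × ℂ) : Prop :=
  ContDiff ℝ ∞ G ∧
  (∀ w ∈ Metric.closedBall (0 : ℂ) r, ‖G w - (w, f w)‖ < δ) ∧
  ∀ w ∈ crossings G r, crossingDet G w ≠ 0

/-- The algebraic number of points of intersection of `ℂ × 0` with the surface `G`. -/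
def crossingNumber (G : ℂ → ℂ × ℂ) (r : ℝ) : ℤ :=
  ∑ᶠ w ∈ crossings G r, (SignType.sign (crossingDet G w) : ℤ)

/-- The graph of the continuous function `f` meets `ℂ × 0` near `0` only at the origin, with
intersection index `k`: the algebraic number of points of intersection of `ℂ × 0` with any
sufficiently small transverse smooth perturbation of the graph. -/
def HasLocalIndex (f : ℂ → ℂ) (k : ℤ) : Prop :=
  ∃ R > 0, ContinuousOn f (Metric.closedBall 0 R) ∧
    (∀ w ∈ Metric.closedBall (0 : ℂ) R, f w = 0 ↔ w = 0) ∧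
    ∀ r, 0 < r → r ≤ R → ∃ ε > 0, ∀ δ, 0 < δ → δ ≤ ε →
      (∃ G, IsTransversePerturbation f r δ G) ∧
      ∀ G, IsTransversePerturbation f r δ G → crossingNumber G r = k

/-- `k` is an intersection index of the half-disks at `u₁ 0 = u₂ 0`: in a graph form in which both
edges lie in the real plane `ℝ × ℝ ⊆ ℂ × ℂ`, the two surfaces, extended by reflection in that
plane, have intersection index `k` at the origin. -/
def IsIntersectionIndex (u₁ u₂ : ℂ → ℂ × ℂ) (k : ℤ) : Prop :=
  ∃ (σ : ℝ) (φ : ℂ → ℂ), IsGraphForm u₁ u₂ σ φ ∧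
    (∀ᶠ x : ℝ in 𝓝 0, (φ x).im = 0) ∧ HasLocalIndex (reflect σ φ) k

end HalfDisk

end

/-! The two half-disks are holomorphic inside and only smooth up to the edge, so near `p` they need
not extend to complex curves. They do have holomorphic Taylor polynomials of every order there,
because the Cauchy–Riemann equations persist on the edge (`holJet_of_smoothNear`). So `C₁` has a
polynomial defining function `Φ`, holomorphic on `ℂ²`, nonsingular at `p` and vanishing on `C₁` up
to order `d + 1`; along a parametrisation of `C₂` it is `c z^m + O(|z|^(m+1))` or is `O(|z|^(d+1))`.

In any graph form, pushing `Φ` forward by the diffeomorphism shows that `φ(w) = L(c σ^m A(w)^m) +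
o(|w|^m)` on the whole half-disk (`graph_sub_isLittleO`). Here `L` is real linear with positive
determinant, since complex normals are oriented, and `A` keeps the direction of the edge and the
inner side. Restriction to the real axis identifies `m` with `d`. Neither `Φ` nor `c` depends on the
graph form, hence neither does the conclusion.

If `φ` is real on the edge, the leading coefficient along the edge is real. A real linear map that
fixes the real axis and preserves the upper half-plane has no eigenvalue `≤ 0`, so `A` and `L` can
be removed by logarithms that are real on the real axis. This gives `φ = c₁ w^d exp k` with `c₁`
real and `k` real on the edge. The form survives reflection, so the extended function has winding
number `d` on small circles (`hasLocalIndex_reflect`). Winding numbers count the zeros of transverse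
perturbations with sign (`sum_sign_det_eq`), so the index is `d`.

A graph form with real edges exists because `φ` on the edge is `x^d` times a nonvanishing smooth
function, which an orientation-preserving change of the normal coordinate removes. Finally, `d = 1`
exactly when `dΦ` does not kill the tangent of `C₂`, that is, when the complex tangent lines differ.
-/

namespace HalfDisk

/-! ### Winding numbers by continuous logarithms -/

/-- `f` and `g` differ on `S` by a factor with a continuous logarithm. -/
def LogEquivOn (S : Set ℂ) (f g : ℂ → ℂ) : Prop :=
  ∃ h : ℂ → ℂ, ContinuousOn h S ∧ ∀ w ∈ S, f w = g w * Complex.exp (h w)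

namespace LogEquivOn

variable {S : Set ℂ} {f g f₁ g₁ k : ℂ → ℂ}

theorem of_eqOn (h : Set.EqOn f g S) : LogEquivOn S f g :=
  ⟨fun _ => 0, continuousOn_const, fun w hw => by simp [h hw]⟩

theorem refl (S : Set ℂ) (f : ℂ → ℂ) : LogEquivOn S f f := of_eqOn fun _ _ => rfl

theorem symm (h : LogEquivOn S f g) : LogEquivOn S g f := by
  obtain ⟨u, hu, hfg⟩ := h
  refine ⟨fun w => -u w, hu.neg, fun w hw => ?_⟩
  rw [hfg w hw, mul_assoc, ← Complex.exp_add]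
  simp

theorem trans (h : LogEquivOn S f g) (h' : LogEquivOn S g k) : LogEquivOn S f k := by
  obtain ⟨u, hu, hfg⟩ := h
  obtain ⟨v, hv, hgk⟩ := h'
  refine ⟨fun w => v w + u w, hv.add hu, fun w hw => ?_⟩
  rw [hfg w hw, hgk w hw, Complex.exp_add, mul_assoc]

theorem mul (h : LogEquivOn S f g) (h' : LogEquivOn S f₁ g₁) :
    LogEquivOn S (fun w => f w * f₁ w) (fun w => g w * g₁ w) := by
  obtain ⟨u, hu, hfg⟩ := h
  obtain ⟨v, hv, hgk⟩ := h'
  refine ⟨fun w => u w + v w, hu.add hv, fun w hw => ?_⟩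
  simp only [hfg w hw, hgk w hw, Complex.exp_add]
  ring

theorem zpow (h : LogEquivOn S f g) (n : ℤ) :
    LogEquivOn S (fun w => f w ^ n) (fun w => g w ^ n) := by
  obtain ⟨u, hu, hfg⟩ := h
  refine ⟨fun w => n * u w, continuousOn_const.mul hu, fun w hw => ?_⟩
  simp only [hfg w hw, mul_zpow, Complex.exp_int_mul]

theorem mono {T : Set ℂ} (h : LogEquivOn S f g) (hT : T ⊆ S) : LogEquivOn T f g := by
  obtain ⟨u, hu, hfg⟩ := h
  exact ⟨u, hu.mono hT, fun w hw => hfg w (hT hw)⟩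

theorem const (S : Set ℂ) {a : ℂ} (ha : a ≠ 0) : LogEquivOn S (fun _ => a) (fun _ => 1) :=
  ⟨fun _ => Complex.log a, continuousOn_const, fun w _ => by simp [Complex.exp_log ha]⟩

theorem const_mul {a : ℂ} (ha : a ≠ 0) (f : ℂ → ℂ) : LogEquivOn S (fun w => a * f w) f := by
  have := (const S ha).mul (refl S f)
  simpa using this

/-- Rouché's argument: `f / g` lies in the unit disk about `1`, where the principal logarithm is
continuous. -/
theorem of_norm_sub_lt (hf : ContinuousOn f S) (hg : ContinuousOn g S)
    (h : ∀ w ∈ S, ‖f w - g w‖ < ‖g w‖) : LogEquivOn S f g := by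
  have hg0 : ∀ w ∈ S, g w ≠ 0 := fun w hw h0 => by
    have := h w hw
    rw [h0, norm_zero] at this
    exact absurd this (not_lt.2 (norm_nonneg _))
  have hs : ∀ w ∈ S, f w / g w ∈ Complex.slitPlane := fun w hw => by
    have h1 : f w / g w = 1 + (f w - g w) / g w := by
      have := hg0 w hw
      field_simp
      ring
    rw [h1]
    apply Complex.mem_slitPlane_of_norm_lt_one
    rw [norm_div, div_lt_one (norm_pos_iff.2 (hg0 w hw))]
    exact h w hw
  refine ⟨fun w => Complex.log (f w / g w), (hf.div hg hg0).clog hs, fun w hw => ?_⟩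
  rw [Complex.exp_log (Complex.slitPlane_ne_zero (hs w hw)), mul_div_cancel₀ _ (hg0 w hw)]

/-- By compactness `‖H‖` has a positive lower bound `c`, and uniform continuity cuts the homotopy
into finitely many steps smaller than `c`; `of_norm_sub_lt` applies to each step. -/
theorem of_homotopy (hS : IsCompact S) {H : ℝ → ℂ → ℂ}
    (hH : ContinuousOn (fun q : ℝ × ℂ => H q.1 q.2) (Set.Icc 0 1 ×ˢ S))
    (h0 : ∀ t ∈ Set.Icc (0 : ℝ) 1, ∀ w ∈ S, H t w ≠ 0) : LogEquivOn S (H 1) (H 0) := by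
  have hK : IsCompact (Set.Icc (0 : ℝ) 1 ×ˢ S) := isCompact_Icc.prod hS
  obtain ⟨c, hc, hcH⟩ : ∃ c > 0, ∀ q ∈ Set.Icc (0 : ℝ) 1 ×ˢ S, c ≤ ‖H q.1 q.2‖ := by
    rcases (Set.Icc (0 : ℝ) 1 ×ˢ S).eq_empty_or_nonempty with he | hne
    · exact ⟨1, one_pos, by simp [he]⟩
    · obtain ⟨q, hq, hmin⟩ := hK.exists_isMinOn hne hH.norm
      exact ⟨‖H q.1 q.2‖, norm_pos_iff.2 (h0 _ hq.1 _ hq.2), fun p hp => hmin hp⟩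
  have huc := hK.uniformContinuousOn_of_continuous hH
  rw [Metric.uniformContinuousOn_iff] at huc
  obtain ⟨δ, hδ, hd⟩ := huc c hc
  obtain ⟨n, hn⟩ := exists_nat_gt (1 / δ)
  have hn0 : (0 : ℝ) < n := lt_trans (by positivity) hn
  have hcont : ∀ t ∈ Set.Icc (0 : ℝ) 1, ContinuousOn (H t) S := fun t ht =>
    hH.comp (f := fun w => (t, w)) (by fun_prop) fun w hw => ⟨ht, hw⟩
  have hmem : ∀ j : ℕ, j ≤ n → (j : ℝ) / n ∈ Set.Icc (0 : ℝ) 1 := fun j hj =>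
    ⟨by positivity, (div_le_one hn0).2 (by exact_mod_cast hj)⟩
  have key : ∀ j : ℕ, j ≤ n → LogEquivOn S (H ((j : ℝ) / n)) (H 0) := by
    intro j
    induction j with
    | zero => intro _; simpa using refl S (H 0)
    | succ j ih =>
      intro hj
      have hj' : j ≤ n := by omega
      refine trans (of_norm_sub_lt (hcont _ (hmem _ hj)) (hcont _ (hmem _ hj')) ?_) (ih hj')
      intro w hw
      refine lt_of_lt_of_le ?_ (hcH ((j : ℝ) / n, w) ⟨hmem _ hj', hw⟩)
      rw [← dist_eq_norm]
      refine hd (((j + 1 : ℕ) : ℝ) / n, w) ⟨hmem _ hj, hw⟩ ((j : ℝ) / n, w) ⟨hmem _ hj', hw⟩ ?_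
      rw [Prod.dist_eq, dist_self, Real.dist_eq, max_eq_left (abs_nonneg _)]
      have : ((j + 1 : ℕ) : ℝ) / n - (j : ℝ) / n = 1 / n := by push_cast; ring
      rw [this, abs_of_pos (by positivity), div_lt_comm₀ hn0 hδ]
      exact hn
  have := key n le_rfl
  rwa [div_self hn0.ne'] at this

end LogEquivOn

theorem eq_of_zpow_logEquivOn_sphere {r : ℝ} (hr : 0 < r) {m n : ℤ}
    (h : LogEquivOn (Metric.sphere 0 r) (fun w => w ^ m) (fun w => w ^ n)) : m = n := by
  obtain ⟨u, hu, he⟩ := h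
  have hmem : ∀ θ : ℝ, (r : ℂ) * Complex.exp (θ * Complex.I) ∈ Metric.sphere (0 : ℂ) r := fun θ => by
    simp [Complex.norm_exp_ofReal_mul_I, abs_of_pos hr]
  -- The given logarithm `u` minus a logarithm of `w ^ (m - n)` along the circle. It takes values in
  -- `2πiℤ`, so it is constant; since `u` is periodic, its change over one turn is a multiple of `m
  -- - n`.
  set v : ℝ → ℂ := fun θ => u (r * Complex.exp (θ * Complex.I)) -
    (m - n : ℤ) * (Real.log r + θ * Complex.I) with hv
  have hvc : Continuous v := by
    refine Continuous.sub ?_ (by fun_prop)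
    exact hu.comp_continuous (by fun_prop) hmem
  have hr0 : (r : ℂ) ≠ 0 := by exact_mod_cast hr.ne'
  have hexp : ∀ θ, Complex.exp (v θ) = 1 := fun θ => by
    have h1 := he _ (hmem θ)
    beta_reduce at h1
    have h2 : (r : ℂ) * Complex.exp (θ * Complex.I) = Complex.exp (Real.log r + θ * Complex.I) := by
      rw [Complex.exp_add, ← Complex.ofReal_exp, Real.exp_log hr]
    have h3 : ((r : ℂ) * Complex.exp (θ * Complex.I)) ≠ 0 :=
      mul_ne_zero hr0 (Complex.exp_ne_zero _)
    rw [hv]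
    simp only
    rw [Complex.exp_sub, Complex.exp_int_mul, ← h2, div_eq_one_iff_eq (zpow_ne_zero _ h3),
      zpow_sub₀ h3, eq_div_iff (zpow_ne_zero _ h3), h1, mul_comm]
  have hint : ∀ θ, (v θ / (2 * Real.pi * Complex.I)).re ∈ Set.range ((↑) : ℤ → ℝ) := fun θ => by
    obtain ⟨j, hj⟩ := Complex.exp_eq_one_iff.1 (hexp θ)
    refine ⟨j, ?_⟩
    rw [hj, mul_div_assoc, div_self Complex.two_pi_I_ne_zero, mul_one, Complex.intCast_re]
  have hconst := isPreconnected_univ.constant_of_mapsTo (S := (Set.univ : Set ℝ))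
    (T := Set.range ((↑) : ℤ → ℝ)) (f := fun θ => (v θ / (2 * Real.pi * Complex.I)).re)
    (by exact Int.isClosedEmbedding_coe_real.isEmbedding.isDiscrete_range)
    (by fun_prop) (fun θ _ => hint θ) (Set.mem_univ 0) (Set.mem_univ (2 * Real.pi))
  have hv0 : v 0 - v (2 * Real.pi) = (m - n : ℤ) * (2 * Real.pi * Complex.I) := by
    simp only [hv]
    have : Complex.exp (((2 * Real.pi : ℝ) : ℂ) * Complex.I) = 1 := by
      push_cast; exact Complex.exp_two_pi_mul_I
    rw [this]
    push_cast
    simp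
    ring
  have h4 : ((v 0 - v (2 * Real.pi)) / (2 * Real.pi * Complex.I)).re = 0 := by
    rw [sub_div, Complex.sub_re]
    exact sub_eq_zero.2 hconst
  rw [hv0, mul_div_assoc, div_self Complex.two_pi_I_ne_zero, mul_one, Complex.intCast_re] at h4
  have h5 : m - n = 0 := by exact_mod_cast h4
  omega

/-- The map `f` has index `n` at `c`: its winding number on small circles around `c` is `n`. -/
def HasIndexAt (f : ℂ → ℂ) (c : ℂ) (n : ℤ) : Prop :=
  ∀ᶠ ρ in 𝓝[>] (0 : ℝ), LogEquivOn (Metric.sphere c ρ) f fun w => (w - c) ^ n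

/-- The values of `w - a` stay in a disk about `b - a` that misses `0`. Hence a factor with its zero
at `a` does not affect the index at `b`. -/
theorem logEquivOn_sub_zpow_one {S : Set ℂ} {a b : ℂ} (hab : a ≠ b)
    (hS : ∀ w ∈ S, ‖w - b‖ < ‖b - a‖) (n : ℤ) :
    LogEquivOn S (fun w => (w - a) ^ n) (fun _ => 1) := by
  have h1 : LogEquivOn S (fun w => w - a) (fun _ => b - a) :=
    LogEquivOn.of_norm_sub_lt (by fun_prop) (by fun_prop) fun w hw => by
      simpa using hS w hw
  have h2 := (h1.trans (LogEquivOn.const S (sub_ne_zero.2 hab.symm))).zpow n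
  simpa using h2

/-- The homotopy `f (t w)` contracts the disk to its centre. -/
theorem logEquivOn_one_of_ne_zero {r : ℝ} (hr : 0 ≤ r) {f : ℂ → ℂ}
    (hf : ContinuousOn f (Metric.closedBall 0 r)) (h0 : ∀ w ∈ Metric.closedBall 0 r, f w ≠ 0) :
    LogEquivOn (Metric.closedBall 0 r) f (fun _ => 1) := by
  have hmaps : ∀ q ∈ Set.Icc (0 : ℝ) 1 ×ˢ Metric.closedBall (0 : ℂ) r,
      (q.1 : ℂ) * q.2 ∈ Metric.closedBall (0 : ℂ) r := by
    rintro ⟨t, w⟩ ⟨⟨ht0, ht1⟩, hw⟩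
    simp only [mem_closedBall_zero_iff, norm_mul, Complex.norm_real, Real.norm_eq_abs] at hw ⊢
    rw [abs_of_nonneg ht0]
    nlinarith [norm_nonneg w]
  have h := LogEquivOn.of_homotopy (isCompact_closedBall (0 : ℂ) r)
    (H := fun t w => f ((t : ℂ) * w))
    (hf.comp (f := fun q : ℝ × ℂ => (q.1 : ℂ) * q.2) (by fun_prop) hmaps)
    (fun t ht w hw => h0 _ (hmaps (t, w) ⟨ht, hw⟩))
  refine LogEquivOn.trans (g := fun _ => f 0) ?_
    (LogEquivOn.const _ (h0 0 (Metric.mem_closedBall_self hr)))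
  simpa using h

/-- The zero `c` of `f` can be removed by changing `f` near `c` and dividing it by `(w - c) ^ n`
away from `c`. -/
theorem exists_removal {f : ℂ → ℂ} {K : Set ℂ} (hK : IsClosed K) {c : ℂ} {n : ℤ} {ρ : ℝ}
    (hρ : 0 < ρ) (hf : ContinuousOn f K)
    (hc : LogEquivOn (Metric.sphere c ρ) f fun w => (w - c) ^ n) :
    ∃ F : ℂ → ℂ, ContinuousOn F K ∧ (∀ w ∈ Metric.ball c ρ, F w ≠ 0) ∧
      ∀ w ∉ Metric.ball c ρ, F w = f w * (w - c) ^ (-n) := by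
  classical
  obtain ⟨h, hh, hfh⟩ := hc
  -- The logarithm of `f w * (w - c) ^ (-n)` on the circle extends by Tietze to the plane. Its
  -- exponential fills the disk without zeros and matches the outer function on the circle.
  obtain ⟨g, hg⟩ := ContinuousMap.exists_restrict_eq (Y := ℂ) (Metric.isClosed_sphere (x := c) (ε := ρ))
    ⟨_, continuousOn_iff_continuous_domRestrict.1 hh⟩
  have hgh : ∀ w ∈ Metric.sphere c ρ, g w = h w := fun w hw => by
    have := congrArg (fun q => q ⟨w, hw⟩) hg
    simpa using this
  set F : ℂ → ℂ := fun w => if w ∈ Metric.ball c ρ then Complex.exp (g w) else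
    f w * (w - c) ^ (-n) with hF
  have hin : ∀ w ∈ Metric.ball c ρ, F w = Complex.exp (g w) := fun w hw => by simp only [hF, if_pos hw]
  have hout : ∀ w ∉ Metric.ball c ρ, F w = f w * (w - c) ^ (-n) := fun w hw => by
    simp only [hF, if_neg hw]
  have hne : ∀ w ∉ Metric.ball c ρ, w - c ≠ 0 := fun w hw h0 => by
    rw [sub_eq_zero.1 h0] at hw
    exact hw (Metric.mem_ball_self hρ)
  have hclosed : ∀ w ∈ Metric.closedBall c ρ, F w = Complex.exp (g w) := fun w hw => by
    by_cases hb : w ∈ Metric.ball c ρ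
    · exact hin w hb
    · have hs : w ∈ Metric.sphere c ρ := by
        rw [Metric.mem_sphere]
        exact le_antisymm hw (not_lt.1 hb)
      rw [hout w hb, hfh w hs, hgh w hs, zpow_neg, mul_right_comm,
        mul_inv_cancel₀ (zpow_ne_zero _ (hne w hb)), one_mul]
  refine ⟨F, ?_, fun w hw => by rw [hin w hw]; exact Complex.exp_ne_zero _, hout⟩
  have hcover : K ⊆ (Metric.closedBall c ρ) ∪ (K ∩ (Metric.ball c ρ)ᶜ) := fun w hw => by
    by_cases hb : w ∈ Metric.ball c ρ
    · exact Or.inl (Metric.ball_subset_closedBall hb)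
    · exact Or.inr ⟨hw, hb⟩
  refine (ContinuousOn.union_of_isClosed ?_ ?_ Metric.isClosed_closedBall
    (hK.inter Metric.isOpen_ball.isClosed_compl)).mono hcover
  · exact (g.continuous.cexp.continuousOn).congr hclosed
  · refine ContinuousOn.congr ?_ fun w hw => hout w hw.2
    refine (hf.mono Set.inter_subset_left).mul ?_
    exact ContinuousOn.zpow₀ (by fun_prop) _ fun w hw => Or.inl (hne w hw.2)

/-- The winding number of `f` on a circle is the sum of the indices at the zeros inside. -/
theorem logEquivOn_sphere_zpow_sum {r : ℝ} (hr : 0 < r) (s : ℂ → ℤ) (Z : Finset ℂ) (f : ℂ → ℂ)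
    (hf : ContinuousOn f (Metric.closedBall 0 r))
    (hZ : ∀ w ∈ Metric.closedBall 0 r, f w = 0 → w ∈ Z)
    (hs : ∀ z ∈ Z, z ∈ Metric.ball 0 r ∧ HasIndexAt f z (s z)) :
    LogEquivOn (Metric.sphere 0 r) f fun w => w ^ (∑ z ∈ Z, s z) := by
  classical
  induction Z using Finset.induction_on generalizing f with
  | empty =>
    have := (logEquivOn_one_of_ne_zero hr.le hf fun w hw h0 => by simpa using hZ w hw h0).mono
      Metric.sphere_subset_closedBall
    simpa using this
  | insert c Z hcZ ih =>
    obtain ⟨hcr, hci⟩ := hs c (Finset.mem_insert_self _ _)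
    have hev : ∀ᶠ ρ in 𝓝[>] (0 : ℝ), Metric.closedBall c ρ ⊆ Metric.ball 0 r ∧
        ∀ z ∈ Z, z ∉ Metric.closedBall c ρ := by
      have hU : (Metric.ball (0 : ℂ) r) \ Z ∈ 𝓝 c :=
        (Metric.isOpen_ball.sdiff Z.finite_toSet.isClosed).mem_nhds ⟨hcr, hcZ⟩
      obtain ⟨ε, hε, hsub⟩ := Metric.nhds_basis_closedBall.mem_iff.1 hU
      filter_upwards [Ioc_mem_nhdsGT hε] with ρ hρ
      have hsub' := (Metric.closedBall_subset_closedBall hρ.2).trans hsub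
      exact ⟨fun w hw => (hsub' hw).1, fun z hz hz' => (hsub' hz').2 hz⟩
    obtain ⟨ρ, ⟨⟨hball, hdisj⟩, hci'⟩, (hρ : 0 < ρ)⟩ :=
      ((hev.and hci).and self_mem_nhdsWithin).exists
    obtain ⟨F, hFc, hFin, hFout⟩ := exists_removal Metric.isClosed_closedBall hρ hf hci'
    have hneout : ∀ w ∉ Metric.ball c ρ, w - c ≠ 0 := fun w hw h0 => by
      rw [sub_eq_zero.1 h0] at hw
      exact hw (Metric.mem_ball_self hρ)
    -- The modified `F` has no zero near `c` and keeps the indices at the other points. On the outer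
    -- circle `f = F * (w - c) ^ s c`, and there `w - c` winds like `w`.
    have hF := ih F hFc ?_ ?_
    · have hsph : ∀ w ∈ Metric.sphere (0 : ℂ) r, w ∉ Metric.ball c ρ := fun w hw hb => by
        have h1 := hball (Metric.ball_subset_closedBall hb)
        rw [mem_ball_zero_iff] at h1
        rw [mem_sphere_zero_iff_norm] at hw
        linarith
      have h1 : LogEquivOn (Metric.sphere 0 r) (fun w => w - c) (fun w => w) :=
        LogEquivOn.of_norm_sub_lt (by fun_prop) (by fun_prop) fun w hw => by
          rw [mem_sphere_zero_iff_norm] at hw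
          rw [mem_ball_zero_iff] at hcr
          simpa [hw] using hcr
      have h2 := hF.mul (h1.zpow (s c))
      refine LogEquivOn.trans (LogEquivOn.of_eqOn fun w hw => ?_)
        (h2.trans (LogEquivOn.of_eqOn fun w hw => ?_))
      · have hw' := hsph w hw
        rw [hFout w hw', mul_assoc, ← zpow_add₀ (hneout w hw')]
        simp
      · have hw0 : w ≠ 0 := fun h => by
          rw [mem_sphere_zero_iff_norm, h, norm_zero] at hw
          linarith
        rw [Finset.sum_insert hcZ, ← zpow_add₀ hw0, add_comm]
    · intro w hw h0
      by_cases hb : w ∈ Metric.ball c ρ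
      · exact absurd h0 (hFin w hb)
      · rw [hFout w hb] at h0
        rcases Finset.mem_insert.1 (hZ w hw
          ((mul_eq_zero.1 h0).resolve_right (zpow_ne_zero _ (hneout w hb)))) with h | h
        · exact absurd (Metric.mem_ball_self hρ) (h ▸ hb)
        · exact h
    · intro z hz
      obtain ⟨hzr, hzi⟩ := hs z (Finset.mem_insert_of_mem hz)
      refine ⟨hzr, ?_⟩
      have hzc : c ≠ z := fun h => hcZ (h ▸ hz)
      have hU : (Metric.closedBall c ρ)ᶜ ∩ {w | ‖w - z‖ < ‖z - c‖} ∈ 𝓝 z := by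
        refine inter_mem (Metric.isClosed_closedBall.isOpen_compl.mem_nhds (hdisj z hz))
          ((isOpen_lt (by fun_prop) (by fun_prop)).mem_nhds ?_)
        simpa [sub_eq_zero] using hzc.symm
      obtain ⟨ε, hε, hsub⟩ := Metric.nhds_basis_closedBall.mem_iff.1 hU
      unfold HasIndexAt at hzi ⊢
      filter_upwards [hzi, Ioc_mem_nhdsGT hε] with ρ' hρ' hρε
      have hsub' : Metric.sphere z ρ' ⊆ _ := (Metric.sphere_subset_closedBall.trans
        (Metric.closedBall_subset_closedBall hρε.2)).trans hsub
      have h1 := hρ'.mul (logEquivOn_sub_zpow_one (S := Metric.sphere z ρ') hzc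
        (fun w hw => (hsub' hw).2) (-s c))
      refine LogEquivOn.trans (LogEquivOn.of_eqOn fun w hw => ?_)
        (h1.trans (LogEquivOn.of_eqOn fun w _ => ?_))
      · exact hFout w fun hb => (hsub' hw).1 (Metric.ball_subset_closedBall hb)
      · simp

/-! ### Signed zeros, transverse perturbations and the local index -/

theorem det_complex (D : ℂ →ₗ[ℝ] ℂ) :
    LinearMap.det D = (D 1).re * (D Complex.I).im - (D Complex.I).re * (D 1).im := by
  rw [← LinearMap.det_toMatrix Complex.basisOneI, Matrix.det_fin_two]
  simp [LinearMap.toMatrix_apply]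

/-- The determinant of a block triangular map. -/
theorem det_of_triangular (T : ℂ × ℂ →ₗ[ℝ] ℂ × ℂ) (A M : ℂ →ₗ[ℝ] ℂ)
    (hA : ∀ z, T (z, 0) = (A z, 0)) (hM : ∀ t, (T (0, t)).2 = M t) :
    LinearMap.det T = LinearMap.det A * LinearMap.det M := by
  have h : LinearMap.toMatrix (Complex.basisOneI.prod Complex.basisOneI)
      (Complex.basisOneI.prod Complex.basisOneI) T =
      Matrix.fromBlocks (LinearMap.toMatrix Complex.basisOneI Complex.basisOneI A)
        (LinearMap.toMatrix Complex.basisOneI Complex.basisOneI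
          (LinearMap.fst ℝ ℂ ℂ ∘ₗ T ∘ₗ LinearMap.inr ℝ ℂ ℂ)) 0
        (LinearMap.toMatrix Complex.basisOneI Complex.basisOneI M) := by
    ext (i | i) (j | j) <;> simp [LinearMap.toMatrix_apply, hA, ← hM]
  rw [← LinearMap.det_toMatrix (Complex.basisOneI.prod Complex.basisOneI), h,
    Matrix.det_fromBlocks_zero₂₁, LinearMap.det_toMatrix, LinearMap.det_toMatrix]

/-- The coefficients are the Wirtinger derivatives of `D`; the sign of the determinant tells which
of them dominates. -/
theorem exists_eq_mul_add_mul_conj (D : ℂ →ₗ[ℝ] ℂ) :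
    ∃ a b : ℂ, (∀ w, D w = a * w + b * conj w) ∧ LinearMap.det D = ‖a‖ ^ 2 - ‖b‖ ^ 2 := by
  refine ⟨(D 1 - Complex.I * D Complex.I) / 2, (D 1 + Complex.I * D Complex.I) / 2, fun w => ?_, ?_⟩
  · have h : D w = w.re * D 1 + w.im * D Complex.I := by
      have h1 : w = w.re • (1 : ℂ) + w.im • Complex.I := by
        simp [Complex.re_add_im]
      conv_lhs => rw [h1]
      rw [map_add, map_smul, map_smul]
      simp
    rw [h]
    apply Complex.ext <;> simp <;> ring
  · rw [det_complex, ← Complex.normSq_eq_norm_sq, ← Complex.normSq_eq_norm_sq]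
    simp [Complex.normSq_apply]
    ring

/-- On small circles `g` is compared with its differential, and the differential with the dominant
one of its terms `a w` and `b conj w`. -/
theorem hasIndexAt_sign_det {g : ℂ → ℂ} {D : ℂ →L[ℝ] ℂ} {c : ℂ} (hg : Continuous g)
    (hD : HasFDerivAt g D c) (hc : g c = 0) (hdet : LinearMap.det (D : ℂ →ₗ[ℝ] ℂ) ≠ 0) :
    HasIndexAt g c (SignType.sign (LinearMap.det (D : ℂ →ₗ[ℝ] ℂ)) : ℤ) := by
  obtain ⟨a, b, hab, hdab⟩ := exists_eq_mul_add_mul_conj (D : ℂ →ₗ[ℝ] ℂ)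
  have hab' : ∀ w, D w = a * w + b * conj w := hab
  have hne : ‖a‖ ≠ ‖b‖ := fun h => hdet (by rw [hdab, h, sub_self])
  set m := |‖a‖ - ‖b‖| with hm
  have hm0 : 0 < m := abs_pos.2 (sub_ne_zero.2 hne)
  have hlow : ∀ w, m * ‖w‖ ≤ ‖D w‖ := fun w => by
    have h1 := abs_norm_sub_norm_le (a * w) (-(b * conj w))
    rw [norm_neg, norm_mul, norm_mul, RCLike.norm_conj, ← sub_mul, abs_mul, abs_norm,
      sub_neg_eq_add, ← hab'] at h1
    exact h1
  have hsmall := (hasFDerivAt_iff_isLittleO.1 hD).def (half_pos hm0)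
  obtain ⟨ε, hε, hsub⟩ := Metric.nhds_basis_closedBall.eventually_iff.1 hsmall
  unfold HasIndexAt
  filter_upwards [Ioc_mem_nhdsGT hε] with ρ hρ
  have hnorm : ∀ w ∈ Metric.sphere c ρ, ‖w - c‖ = ρ := fun w hw => by
    rw [← dist_eq_norm]; exact hw
  have h1 : LogEquivOn (Metric.sphere c ρ) g (fun w => D (w - c)) :=
    LogEquivOn.of_norm_sub_lt hg.continuousOn (by fun_prop) fun w hw => by
      have h2 := hsub (x := w) (Metric.sphere_subset_closedBall.trans
        (Metric.closedBall_subset_closedBall hρ.2) hw)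
      rw [hc, sub_zero] at h2
      refine lt_of_le_of_lt h2 (lt_of_lt_of_le ?_ (hlow (w - c)))
      rw [hnorm w hw]
      nlinarith [hρ.1]
  refine h1.trans ?_
  rcases lt_or_gt_of_ne hne with hlt | hgt
  · have hs : LinearMap.det (D : ℂ →ₗ[ℝ] ℂ) < 0 := by
      rw [hdab]; nlinarith [norm_nonneg a]
    have hb : b ≠ 0 := fun h => by
      rw [h, norm_zero] at hlt
      exact absurd hlt (not_lt.2 (norm_nonneg _))
    rw [sign_neg hs]
    have h2 : LogEquivOn (Metric.sphere c ρ) (fun w => D (w - c)) (fun w => b * conj (w - c)) :=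
      LogEquivOn.of_norm_sub_lt (by fun_prop) (by fun_prop) fun w hw => by
        rw [hab', add_sub_cancel_right, norm_mul, norm_mul, RCLike.norm_conj, hnorm w hw]
        exact mul_lt_mul_of_pos_right hlt hρ.1
    -- On the circle `conj (w - c) = ρ² / (w - c)`, which gives the index `-1`.
    have hρ0 : (ρ : ℂ) ^ 2 ≠ 0 := pow_ne_zero _ (by exact_mod_cast hρ.1.ne')
    refine h2.trans ((LogEquivOn.const_mul hb _).trans (LogEquivOn.trans
      (LogEquivOn.of_eqOn fun w hw => ?_) (LogEquivOn.const_mul hρ0 _)))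
    have hw0 : w - c ≠ 0 := norm_pos_iff.1 (by rw [hnorm w hw]; exact hρ.1)
    rw [SignType.coe_neg_one, zpow_neg_one, eq_mul_inv_iff_mul_eq₀ hw0, Complex.conj_mul',
      hnorm w hw]
  · have hs : 0 < LinearMap.det (D : ℂ →ₗ[ℝ] ℂ) := by
      rw [hdab]; nlinarith [norm_nonneg b]
    have ha : a ≠ 0 := fun h => by
      rw [h, norm_zero] at hgt
      exact absurd hgt (not_lt.2 (norm_nonneg _))
    rw [sign_pos hs]
    have h2 : LogEquivOn (Metric.sphere c ρ) (fun w => D (w - c)) (fun w => a * (w - c)) :=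
      LogEquivOn.of_norm_sub_lt (by fun_prop) (by fun_prop) fun w hw => by
        rw [hab', add_sub_cancel_left, norm_mul, norm_mul, RCLike.norm_conj, hnorm w hw]
        exact mul_lt_mul_of_pos_right hgt hρ.1
    refine h2.trans ((LogEquivOn.const_mul ha _).trans (LogEquivOn.of_eqOn fun w hw => ?_))
    simp

/-- The coproduct with the inclusion of `ℂ × 0` is block triangular, so only the second component of
`G` matters and crossings become zeros of a planar map. -/
theorem crossingDet_eq {G : ℂ → ℂ × ℂ} {w : ℂ} (hG : DifferentiableAt ℝ G w) :
    crossingDet G w = LinearMap.det (fderiv ℝ (fun z => (G z).2) w : ℂ →ₗ[ℝ] ℂ) := by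
  unfold crossingDet
  rw [det_of_triangular _ LinearMap.id (fderiv ℝ (fun z => (G z).2) w : ℂ →ₗ[ℝ] ℂ)]
  · simp
  · intro z; simp
  · intro t
    have h := (hG.hasFDerivAt.snd).fderiv
    simp [h]

/-- An infinite set of zeros in a compact set would accumulate at a zero, but an invertible
differential isolates it. -/
theorem finite_zeros {g : ℂ → ℂ} (hg : ContDiff ℝ ∞ g) {K : Set ℂ} (hK : IsCompact K)
    (hdet : ∀ w ∈ K, g w = 0 → LinearMap.det (fderiv ℝ g w : ℂ →ₗ[ℝ] ℂ) ≠ 0) :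
    {w | w ∈ K ∧ g w = 0}.Finite := by
  have hclosed : IsCompact {w | w ∈ K ∧ g w = 0} :=
    hK.inter_right (isClosed_eq hg.continuous continuous_const)
  by_contra hinf
  obtain ⟨c, hc, hacc⟩ := Set.Infinite.exists_accPt_of_subset_isCompact hinf hclosed subset_rfl
  have hd := hdet c hc.1 hc.2
  let e := (LinearMap.equivOfDetNeZero (fderiv ℝ g c : ℂ →ₗ[ℝ] ℂ) hd).toContinuousLinearEquiv
  have hder : HasFDerivAt g (fderiv ℝ g c) c := (hg.differentiable (by simp) c).hasFDerivAt
  have hne := hder.eventually_ne (c := 0) ⟨_, by exact e.antilipschitz⟩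
  rw [accPt_iff_frequently_nhdsNE] at hacc
  exact hacc (hne.mono fun z hz h => hz h.2)

/-- The algebraic number of zeros of a smooth map is its winding number on the boundary. -/
theorem sum_sign_det_eq {g : ℂ → ℂ} (hg : ContDiff ℝ ∞ g) {r : ℝ} (hr : 0 < r) {n : ℤ}
    (hdet : ∀ w ∈ Metric.closedBall 0 r, g w = 0 → LinearMap.det (fderiv ℝ g w : ℂ →ₗ[ℝ] ℂ) ≠ 0)
    (hn : LogEquivOn (Metric.sphere 0 r) g fun w => w ^ n) :
    ∑ᶠ w ∈ {w | w ∈ Metric.closedBall (0 : ℂ) r ∧ g w = 0},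
      (SignType.sign (LinearMap.det (fderiv ℝ g w : ℂ →ₗ[ℝ] ℂ)) : ℤ) = n := by
  have hfin := finite_zeros hg (isCompact_closedBall (0 : ℂ) r) hdet
  rw [finsum_mem_eq_finite_toFinset_sum _ hfin]
  refine eq_of_zpow_logEquivOn_sphere hr (LogEquivOn.trans ?_ hn)
  refine (logEquivOn_sphere_zpow_sum hr _ _ g hg.continuous.continuousOn
    (fun w hw h0 => hfin.mem_toFinset.2 ⟨hw, h0⟩) fun z hz => ?_).symm
  obtain ⟨hzr, hz0⟩ := hfin.mem_toFinset.1 hz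
  refine ⟨?_, hasIndexAt_sign_det hg.continuous
    (hg.differentiable (by simp) z).hasFDerivAt hz0 (hdet z hzr hz0)⟩
  -- No zero lies on the boundary circle, where `g` is a power of a nonzero number times an
  -- exponential.
  refine Metric.mem_ball.2 (lt_of_le_of_ne (Metric.mem_closedBall.1 hzr) fun h => ?_)
  obtain ⟨u, -, hu⟩ := hn
  have h1 := hu z h
  rw [hz0] at h1
  rcases mul_eq_zero.1 h1.symm with h2 | h2
  · rw [eq_zero_of_zpow_eq_zero h2, dist_self] at h
    exact hr.ne h
  · exact Complex.exp_ne_zero _ h2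

theorem crossingNumber_eq {f : ℂ → ℂ} {r δ : ℝ} {n : ℤ} (hr : 0 < r)
    (hf : ContinuousOn f (Metric.sphere 0 r)) (hδ : ∀ w ∈ Metric.sphere (0 : ℂ) r, δ ≤ ‖f w‖)
    (hn : LogEquivOn (Metric.sphere 0 r) f fun w => w ^ n) {G : ℂ → ℂ × ℂ}
    (hG : IsTransversePerturbation f r δ G) : crossingNumber G r = n := by
  obtain ⟨hGs, hGd, hGt⟩ := hG
  have hdet := fun w => crossingDet_eq (w := w) (hGs.differentiable (by simp) w)
  have hg : ContDiff ℝ ∞ fun w => (G w).2 := hGs.snd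
  unfold crossingNumber
  simp only [hdet]
  refine sum_sign_det_eq hg hr (fun w hw h0 => ?_) ?_
  · rw [← hdet]
    exact hGt w ⟨hw, h0⟩
  · refine LogEquivOn.trans (LogEquivOn.of_norm_sub_lt hg.continuous.continuousOn hf ?_) hn
    intro w hw
    exact lt_of_le_of_lt (norm_snd_le (G w - (w, f w)))
      ((hGd w (Metric.sphere_subset_closedBall hw)).trans_le (hδ w hw))

theorem exists_isTransversePerturbation {f : ℂ → ℂ} {r δ : ℝ} (hδ : 0 < δ)
    (hf : ContinuousOn f (Metric.closedBall 0 r)) : ∃ G, IsTransversePerturbation f r δ G := by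
  obtain ⟨F, hF⟩ := ContinuousMap.exists_restrict_eq (Y := ℂ)
    (Metric.isClosed_closedBall (x := (0 : ℂ)) (ε := r))
    ⟨_, continuousOn_iff_continuous_domRestrict.1 hf⟩
  have hFf : ∀ w ∈ Metric.closedBall (0 : ℂ) r, F w = f w := fun w hw => by
    have := congrArg (fun q => q ⟨w, hw⟩) hF
    simpa using this
  obtain ⟨g, hg, hgF, -⟩ := F.continuous.exists_contDiff_approx (⊤ : ℕ∞) (ε := fun _ => δ / 2)
    continuous_const (fun _ => half_pos hδ)
  -- Sard's theorem: almost every constant is a regular value of the smooth approximation `g`, so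
  -- subtracting one smaller than `δ / 2` makes the graph transverse.
  have hnull := MeasureTheory.addHaar_image_eq_zero_of_det_fderivWithin_eq_zero
    (MeasureTheory.volume : MeasureTheory.Measure ℂ) (f := g) (f' := fderiv ℝ g)
    (s := {w | (fderiv ℝ g w).det = 0})
    (fun w _ => (hg.differentiable (by simp) w).hasFDerivAt.hasFDerivWithinAt) (fun w hw => hw)
  obtain ⟨c, hcb, hc⟩ : ∃ c ∈ Metric.ball (0 : ℂ) (δ / 2), c ∉ g '' {w | (fderiv ℝ g w).det = 0} := by
    by_contra! h
    have h1 := MeasureTheory.measure_mono_null (μ := MeasureTheory.volume) (fun c hc => h c hc) hnull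
    exact (Metric.measure_ball_pos MeasureTheory.volume (0 : ℂ) (half_pos hδ)).ne' h1
  have hG : ContDiff ℝ ∞ fun w => (w, g w - c) := contDiff_id.prodMk (hg.sub contDiff_const)
  refine ⟨fun w => (w, g w - c), hG, fun w hw => ?_, fun w hw => ?_⟩
  · have h1 := hgF w
    rw [hFf w hw, dist_eq_norm] at h1
    rw [mem_ball_zero_iff] at hcb
    have h2 : ((w, g w - c) : ℂ × ℂ) - (w, f w) = (0, (g w - f w) - c) := by
      ext1 <;> simp; ring
    rw [h2, Prod.norm_def, norm_zero, max_eq_right (norm_nonneg _)]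
    calc _ ≤ ‖g w - f w‖ + ‖c‖ := norm_sub_le _ _
      _ < δ := by linarith
  · rw [crossingDet_eq (hG.differentiable (by simp) w)]
    intro h0
    refine hc ⟨w, ?_, sub_eq_zero.1 hw.2⟩
    rw [fderiv_sub_const] at h0
    exact h0

theorem hasLocalIndex_of_logEquivOn {f : ℂ → ℂ} {n : ℤ} {R : ℝ} (hR : 0 < R)
    (hf : ContinuousOn f (Metric.closedBall 0 R))
    (h0 : ∀ w ∈ Metric.closedBall (0 : ℂ) R, f w = 0 ↔ w = 0)
    (hn : ∀ r, 0 < r → r ≤ R → LogEquivOn (Metric.sphere 0 r) f fun w => w ^ n) :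
    HasLocalIndex f n := by
  refine ⟨R, hR, hf, h0, fun r hr hrR => ?_⟩
  have hball := Metric.closedBall_subset_closedBall (x := (0 : ℂ)) hrR
  have hsph : ContinuousOn f (Metric.sphere 0 r) :=
    hf.mono (Metric.sphere_subset_closedBall.trans hball)
  obtain ⟨q, hq, hmin⟩ := (isCompact_sphere (0 : ℂ) r).exists_isMinOn
    (NormedSpace.sphere_nonempty.2 hr.le) hsph.norm
  have hfq : f q ≠ 0 := fun h => by
    rw [(h0 q (hball (Metric.sphere_subset_closedBall hq))).1 h, mem_sphere_zero_iff_norm,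
      norm_zero] at hq
    exact hr.ne hq
  -- The minimum of `‖f‖` on the circle bounds the perturbations that cannot change the winding
  -- number there.
  refine ⟨‖f q‖, norm_pos_iff.2 hfq, fun δ hδ hδq =>
    ⟨exists_isTransversePerturbation hδ (hf.mono hball), fun G hG => ?_⟩⟩
  exact crossingNumber_eq hr hsph (fun w hw => hδq.trans (hmin hw)) (hn r hr hrR) hG

/-- The definition guarantees a perturbation at every small scale, so one perturbation is admissible
for both indices and computes both. -/
theorem HasLocalIndex.unique {f : ℂ → ℂ} {m n : ℤ} (hm : HasLocalIndex f m)
    (hn : HasLocalIndex f n) : m = n := by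
  obtain ⟨R, hR, -, -, h⟩ := hm
  obtain ⟨R', hR', -, -, h'⟩ := hn
  obtain ⟨ε, hε, hd⟩ := h (min R R') (lt_min hR hR') (min_le_left _ _)
  obtain ⟨ε', hε', hd'⟩ := h' (min R R') (lt_min hR hR') (min_le_right _ _)
  obtain ⟨⟨G, hG⟩, hk⟩ := hd (min ε ε') (lt_min hε hε') (min_le_left _ _)
  obtain ⟨-, hk'⟩ := hd' (min ε ε') (lt_min hε hε') (min_le_right _ _)
  rw [← hk G hG, ← hk' G hG]

/-! ### Flat functions and holomorphic jets -/

open Asymptotics Polynomial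

section Flat

variable {E F : Type*} [NormedAddCommGroup E] [NormedSpace ℝ E] [NormedAddCommGroup F]
  [NormedSpace ℝ F]

theorem SmoothNear.contDiffAt {f : E → F} {x : E} (h : SmoothNear f x) : ContDiffAt ℝ ∞ f x :=
  Eventually.self_of_nhds h

theorem SmoothNear.differentiableAt {f : E → F} {x : E} (h : SmoothNear f x) :
    DifferentiableAt ℝ f x := h.contDiffAt.differentiableAt (by simp)

theorem SmoothNear.eventually_differentiableAt {f : E → F} {x : E} (h : SmoothNear f x) :
    ∀ᶠ y in 𝓝 x, DifferentiableAt ℝ f y :=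
  Eventually.mono h fun _ hy => hy.differentiableAt (by simp)

theorem SmoothNear.hasStrictFDerivAt {f : E → F} {x : E} (h : SmoothNear f x) :
    HasStrictFDerivAt f (fderiv ℝ f x) x := h.contDiffAt.hasStrictFDerivAt (by simp)

theorem SmoothNear.smoothNear_fderiv {f : E → F} {x : E} (h : SmoothNear f x) :
    SmoothNear (fderiv ℝ f) x :=
  Eventually.mono h fun _ hy => hy.fderiv_right (m := ∞) (by simp)

theorem SmoothNear.fderiv_apply {f : E → F} {x : E} (h : SmoothNear f x) (e : E) :
    SmoothNear (fun y => fderiv ℝ f y e) x :=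
  Eventually.mono h.smoothNear_fderiv fun _ hy => hy.clm_apply contDiffAt_const

theorem SmoothNear.comp {G : Type*} [NormedAddCommGroup G] [NormedSpace ℝ G] {g : F → G}
    {f : E → F} {x : E} (hg : SmoothNear g (f x)) (hf : SmoothNear f x) :
    SmoothNear (fun y => g (f y)) x := by
  have h1 := hf.contDiffAt.continuousAt.eventually hg
  unfold SmoothNear at *
  filter_upwards [h1, hf] with y hy hy'
  exact hy.comp y hy'

/-- The mean value inequality on the closed ball of radius `‖z‖`. -/
theorem isBigO_norm_pow_succ_of_fderiv {f : E → F} {N : ℕ}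
    (hd : ∀ᶠ z in 𝓝 (0 : E), DifferentiableAt ℝ f z) (h0 : f 0 = 0)
    (h : fderiv ℝ f =O[𝓝 0] fun z => ‖z‖ ^ N) : f =O[𝓝 0] fun z => ‖z‖ ^ (N + 1) := by
  obtain ⟨C, hC, hb⟩ := h.exists_nonneg
  obtain ⟨ε, hε, hball⟩ := Metric.nhds_basis_ball.eventually_iff.1 (hd.and hb.bound)
  refine IsBigO.of_bound C ?_
  filter_upwards [Metric.ball_mem_nhds (0 : E) hε] with z hz
  have hsub : Metric.closedBall (0 : E) ‖z‖ ⊆ Metric.ball 0 ε := fun y hy => by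
    rw [mem_closedBall_zero_iff] at hy
    rw [mem_ball_zero_iff] at hz ⊢
    exact hy.trans_lt hz
  have h1 := (convex_closedBall (0 : E) ‖z‖).norm_image_sub_le_of_norm_fderiv_le
    (f := f) (C := C * ‖z‖ ^ N) (𝕜 := ℝ) (fun y hy => (hball (hsub hy)).1) (fun y hy => by
      refine (hball (hsub hy)).2.trans ?_
      rw [mem_closedBall_zero_iff] at hy
      rw [norm_pow, norm_norm]
      gcongr) (Metric.mem_closedBall_self (norm_nonneg z)) (y := z) (by simp)
  rw [h0, sub_zero, sub_zero] at h1
  rw [norm_pow, norm_norm, pow_succ, ← mul_assoc]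
  exact h1

end Flat

theorem uniqueDiffOn_halfPlane : UniqueDiffOn ℝ {z : ℂ | 0 ≤ z.im} := by
  refine uniqueDiffOn_convex (convex_halfSpace_im_ge 0) ⟨Complex.I, ?_⟩
  rw [mem_interior_iff_mem_nhds]
  exact mem_of_superset ((isOpen_lt continuous_const Complex.continuous_im).mem_nhds
    (by simp : (0 : ℝ) < Complex.I.im)) fun z (hz : 0 < z.im) => hz.le

theorem eventually_halfPlane_of_ball {p : ℂ → Prop} {ε : ℝ} (hε : 0 < ε)
    (h : ∀ z ∈ Metric.ball (0 : ℂ) ε, 0 ≤ z.im → p z) : ∀ᶠ z in 𝓝[{z : ℂ | 0 ≤ z.im}] 0, p z := by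
  rw [eventually_nhdsWithin_iff]
  filter_upwards [Metric.ball_mem_nhds (0 : ℂ) hε] with z hz hz'
  exact h z hz hz'

theorem exists_ball_halfPlane {p : ℂ → Prop} (h : ∀ᶠ z in 𝓝[{z : ℂ | 0 ≤ z.im}] 0, p z) :
    ∃ ε > 0, ∀ z ∈ Metric.ball (0 : ℂ) ε, 0 ≤ z.im → p z := by
  rw [eventually_nhdsWithin_iff] at h
  obtain ⟨ε, hε, hb⟩ := Metric.nhds_basis_ball.eventually_iff.1 h
  exact ⟨ε, hε, fun z hz hz' => hb hz hz'⟩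

/-- The half-plane has unique differentials even on its edge, so the full differential there is
determined by the values on the half-plane. -/
theorem eventually_fderiv_eq_zero_halfPlane {F : Type*} [NormedAddCommGroup F] [NormedSpace ℝ F]
    {g : ℂ → F} (hg : SmoothNear g 0) (h : ∀ᶠ z in 𝓝[{z : ℂ | 0 ≤ z.im}] 0, g z = 0) :
    ∀ᶠ z in 𝓝[{z : ℂ | 0 ≤ z.im}] 0, fderiv ℝ g z = 0 := by
  filter_upwards [eventually_eventually_nhdsWithin.2 h, self_mem_nhdsWithin,
    hg.eventually_differentiableAt.filter_mono nhdsWithin_le_nhds] with z hz hzH hd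
  rw [← hd.fderivWithin (uniqueDiffOn_halfPlane z hzH)]
  have hz' : g =ᶠ[𝓝[{z : ℂ | 0 ≤ z.im}] z] fun _ => 0 := hz
  rw [hz'.fderivWithin_eq (hz'.self_of_nhdsWithin hzH)]
  simp

/-- A smooth map which vanishes on the half-plane is flat at the origin. -/
theorem isBigO_of_eq_zero_halfPlane (N : ℕ) : ∀ {F : Type} [NormedAddCommGroup F] [NormedSpace ℝ F]
    {g : ℂ → F}, SmoothNear g 0 → (∀ᶠ z in 𝓝[{z : ℂ | 0 ≤ z.im}] 0, g z = 0) →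
    g =O[𝓝 0] fun z => ‖z‖ ^ N := by
  induction N with
  | zero =>
    intro F _ _ g hg _
    simpa using hg.contDiffAt.continuousAt.norm.isBoundedUnder_le.isBigO_one ℝ
  | succ N ih =>
    intro F _ _ g hg h
    exact isBigO_norm_pow_succ_of_fderiv hg.eventually_differentiableAt
      (h.self_of_nhdsWithin (by simp)) (ih hg.smoothNear_fderiv (eventually_fderiv_eq_zero_halfPlane hg h))

/-- `f` has a holomorphic Taylor expansion of infinite order at `0`. -/
def HolJet (f : ℂ → ℂ) : Prop :=
  ∀ N : ℕ, ∃ P : ℂ[X], (fun z => f z - P.eval z) =O[𝓝 0] fun z => ‖z‖ ^ N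

theorem exists_derivative_eq (Q : ℂ[X]) (a : ℂ) : ∃ P : ℂ[X], derivative P = Q ∧ P.eval 0 = a := by
  suffices h : ∃ P : ℂ[X], derivative P = Q by
    obtain ⟨P, hP⟩ := h
    exact ⟨P + C (a - P.eval 0), by simp [hP], by simp⟩
  induction Q using Polynomial.induction_on' with
  | add p q hp hq =>
    obtain ⟨P, rfl⟩ := hp
    obtain ⟨R, rfl⟩ := hq
    exact ⟨P + R, by simp⟩
  | monomial n b =>
    refine ⟨monomial (n + 1) (b / (n + 1)), ?_⟩
    have : (n : ℂ) + 1 ≠ 0 := by exact_mod_cast n.succ_ne_zero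
    rw [derivative_monomial]
    simp [div_mul_cancel₀ _ this]

/-- The derivative `∂f/∂x` again satisfies the Cauchy–Riemann equations on the half-plane. By
induction it has a polynomial jet `Q`, and an antiderivative of `Q` is the next jet of `f`. Off the
half-plane the equations fail only by the flat function `K`. -/
theorem holJet_of_smoothNear {f : ℂ → ℂ} (hf : SmoothNear f 0)
    (h : ∀ᶠ z in 𝓝[{z : ℂ | 0 ≤ z.im}] 0,
      fderiv ℝ f z Complex.I = Complex.I * fderiv ℝ f z 1) : HolJet f := by
  intro N
  induction N generalizing f with
  | zero =>
    refine ⟨0, ?_⟩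
    simpa using hf.contDiffAt.continuousAt.norm.isBoundedUnder_le.isBigO_one ℝ
  | succ N ih =>
    set K : ℂ → ℂ := fun z => fderiv ℝ f z Complex.I - Complex.I * fderiv ℝ f z 1 with hK
    have hf1 := hf.fderiv_apply 1
    have hKs : SmoothNear K 0 := by
      have h1 := hf.fderiv_apply Complex.I
      unfold SmoothNear at h1 hf1 ⊢
      filter_upwards [h1, hf1] with z h1 h2
      exact h1.sub (contDiffAt_const.mul h2)
    have hK0 : ∀ᶠ z in 𝓝[{z : ℂ | 0 ≤ z.im}] 0, K z = 0 := h.mono fun z hz => sub_eq_zero.2 hz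
    have hcr : ∀ᶠ z in 𝓝[{z : ℂ | 0 ≤ z.im}] 0, fderiv ℝ (fun z => fderiv ℝ f z 1) z Complex.I =
        Complex.I * fderiv ℝ (fun z => fderiv ℝ f z 1) z 1 := by
      have hff : ∀ᶠ z in 𝓝 (0 : ℂ), ContDiffAt ℝ ∞ f z := hf
      filter_upwards [eventually_fderiv_eq_zero_halfPlane hKs hK0,
        hff.filter_mono nhdsWithin_le_nhds,
        hf.smoothNear_fderiv.eventually_differentiableAt.filter_mono nhdsWithin_le_nhds] with z hz hsm hd
      have hsymm : IsSymmSndFDerivAt ℝ f z := hsm.isSymmSndFDerivAt (by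
        rw [minSmoothness_of_isRCLikeNormedField]
        exact WithTop.coe_le_coe.2 (le_top : (2 : ℕ∞) ≤ ⊤))
      have hap : ∀ e, HasFDerivAt (fun z => fderiv ℝ f z e) ((fderiv ℝ (fderiv ℝ f) z).flip e) z :=
        fun e => by
          have := hd.hasFDerivAt.clm_apply (hasFDerivAt_const e z)
          simpa using this
      have hKd : HasFDerivAt K ((fderiv ℝ (fderiv ℝ f) z).flip Complex.I -
          Complex.I • (fderiv ℝ (fderiv ℝ f) z).flip 1) z :=
        (hap Complex.I).sub ((hap 1).const_mul Complex.I)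
      rw [hKd.fderiv] at hz
      have h1 := congrArg (fun T : ℂ →L[ℝ] ℂ => T 1) hz
      simp only [sub_apply, ContinuousLinearMap.flip_apply,
        smul_apply, smul_eq_mul, zero_apply] at h1
      rw [(hap 1).fderiv]
      simp only [ContinuousLinearMap.flip_apply]
      -- Symmetry of the second derivative turns the `x`-derivative of `K = 0` into the
      -- Cauchy–Riemann equation for `∂f/∂x`.
      rw [hsymm.eq Complex.I 1]
      exact sub_eq_zero.1 h1
    obtain ⟨Q, hQ⟩ := ih hf1 hcr
    obtain ⟨P, hPQ, hP0⟩ := exists_derivative_eq Q (f 0)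
    refine ⟨P, ?_⟩
    have hPd : ∀ z, HasFDerivAt (fun z => P.eval z)
        ((ContinuousLinearMap.toSpanSingleton ℂ (Q.eval z)).restrictScalars ℝ) z := fun z => by
      rw [← hPQ]
      exact (P.hasDerivAt z).hasFDerivAt.restrictScalars ℝ
    refine isBigO_norm_pow_succ_of_fderiv (hf.eventually_differentiableAt.mono
      fun z hz => hz.sub (hPd z).differentiableAt) (by simp [hP0]) ?_
    refine IsBigO.trans ?_ (hQ.norm_left.add (isBigO_of_eq_zero_halfPlane N hKs hK0).norm_left)
    refine IsBigO.of_bound 1 ?_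
    filter_upwards [hf.eventually_differentiableAt] with z hz
    rw [one_mul, Real.norm_of_nonneg (by positivity)]
    rw [(hz.hasFDerivAt.fun_sub (hPd z)).fderiv]
    refine ContinuousLinearMap.opNorm_le_bound _ (by positivity) fun e => ?_
    -- The differential of the remainder is a complex linear part, controlled by the jet of `∂f/∂x`,
    -- plus the flat defect `K`.
    have he : (fderiv ℝ f z - (ContinuousLinearMap.toSpanSingleton ℂ (Q.eval z)).restrictScalars ℝ) e =
        e * (fderiv ℝ f z 1 - Q.eval z) + e.im * K z := by
      have h1 : fderiv ℝ f z e = e.re * fderiv ℝ f z 1 + e.im * fderiv ℝ f z Complex.I := by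
        have h1 : e = e.re • (1 : ℂ) + e.im • Complex.I := by simp [Complex.re_add_im]
        conv_lhs => rw [h1]
        rw [map_add, map_smul, map_smul]
        simp
      simp only [sub_apply, h1, hK, ContinuousLinearMap.coe_restrictScalars',
        ContinuousLinearMap.toSpanSingleton_apply, smul_eq_mul]
      linear_combination fderiv ℝ f z 1 * Complex.re_add_im e
    rw [he]
    refine (norm_add_le _ _).trans ?_
    rw [norm_mul, norm_mul, Complex.norm_real, add_mul, mul_comm]
    have := Complex.abs_im_le_norm e
    rw [Real.norm_eq_abs, mul_comm |e.im|]
    gcongr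

namespace HolJet

variable {f g : ℂ → ℂ}

theorem polynomial (P : ℂ[X]) : HolJet fun z => P.eval z :=
  fun N => ⟨P, by simpa using isBigO_zero _ _⟩

theorem add (hf : HolJet f) (hg : HolJet g) : HolJet fun z => f z + g z := fun N => by
  obtain ⟨P, hP⟩ := hf N
  obtain ⟨Q, hQ⟩ := hg N
  refine ⟨P + Q, (hP.add hQ).congr_left fun z => ?_⟩
  simp only [eval_add]
  ring

theorem isBigO_one (hf : HolJet f) : f =O[𝓝 0] fun _ => (1 : ℝ) := by
  obtain ⟨P, hP⟩ := hf 0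
  have h1 : (fun z => P.eval z) =O[𝓝 0] fun _ => (1 : ℝ) :=
    P.continuous.continuousAt.norm.isBoundedUnder_le.isBigO_one ℝ
  exact (hP.add (h1.congr_right fun z => (pow_zero _).symm)).congr (fun z => by ring)
    fun z => pow_zero _

theorem mul (hf : HolJet f) (hg : HolJet g) : HolJet fun z => f z * g z := fun N => by
  obtain ⟨P, hP⟩ := hf N
  obtain ⟨Q, hQ⟩ := hg N
  have h1 : (fun z => P.eval z) =O[𝓝 0] fun _ => (1 : ℝ) := (polynomial P).isBigO_one
  have h2 := (hP.mul hg.isBigO_one).add ((h1.mul hQ).congr_right fun z => mul_comm _ _)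
  refine ⟨P * Q, (h2.congr_left fun z => ?_).trans (by simpa using isBigO_refl _ _)⟩
  simp only [eval_mul]
  ring

theorem eval_comp (hf : HolJet f) (P : ℂ[X]) : HolJet fun z => P.eval (f z) := by
  induction P using Polynomial.induction_on' with
  | add p q hp hq => simpa using hp.add hq
  | monomial n b =>
    have hpow : HolJet fun z => f z ^ n := by
      induction n with
      | zero => simpa using polynomial 1
      | succ n ih => simpa [pow_succ] using ih.mul hf
    simpa using (polynomial (C b)).mul hpow

theorem const_mul (hf : HolJet f) (c : ℂ) : HolJet fun z => c * f z := by
  simpa using (polynomial (C c)).mul hf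

theorem sub (hf : HolJet f) (hg : HolJet g) : HolJet fun z => f z - g z := by
  simpa [sub_eq_add_neg] using hf.add (hg.const_mul (-1))

/-- The alternatives are whether `X ^ N` divides the jet of order `N`; if it does not, the
multiplicity of the root `0` gives the leading term. -/
theorem isBigO_or (hf : HolJet f) (N : ℕ) : f =O[𝓝 0] (fun z => ‖z‖ ^ N) ∨
    ∃ m < N, ∃ c : ℂ, c ≠ 0 ∧ (fun z => f z - c * z ^ m) =O[𝓝 0] fun z => ‖z‖ ^ (m + 1) := by
  obtain ⟨P, hP⟩ := hf N
  have hpow : ∀ (j k : ℕ), k ≤ j → (fun z : ℂ => ‖z‖ ^ j) =O[𝓝 0] fun z => ‖z‖ ^ k := fun j k hjk => by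
    refine IsBigO.of_bound 1 ?_
    filter_upwards [Metric.closedBall_mem_nhds (0 : ℂ) one_pos] with z hz
    rw [mem_closedBall_zero_iff] at hz
    rw [one_mul, norm_pow, norm_pow, norm_norm]
    exact pow_le_pow_of_le_one (norm_nonneg z) hz hjk
  have hmul : ∀ (Q : ℂ[X]) (m : ℕ), (fun z : ℂ => (X ^ m * Q).eval z) =O[𝓝 0] fun z => ‖z‖ ^ m :=
    fun Q m => by
      have h1 : (fun z : ℂ => z ^ m) =O[𝓝 0] fun z : ℂ => ‖z‖ ^ m :=
        IsBigO.of_bound 1 (by simp)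
      simpa using h1.mul (polynomial Q).isBigO_one
  by_cases hd : X ^ N ∣ P
  · left
    obtain ⟨Q, rfl⟩ := hd
    simpa using hP.add (hmul Q N)
  · right
    have hP0 : P ≠ 0 := fun h => hd (h ▸ dvd_zero _)
    obtain ⟨Q, hPQ, hQ⟩ := P.exists_eq_pow_rootMultiplicity_mul_and_not_dvd hP0 0
    rw [C_0, sub_zero] at hPQ hQ
    set m := P.rootMultiplicity 0
    have hmN : m < N := by
      by_contra hmN
      exact hd (hPQ ▸ (pow_dvd_pow X (not_lt.1 hmN)).mul_right Q)
    refine ⟨m, hmN, Q.coeff 0, fun h => hQ (X_dvd_iff.2 h), ?_⟩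
    obtain ⟨R, hR⟩ := X_dvd_sub_C (p := Q)
    refine ((hP.trans (hpow _ _ hmN)).add (hmul R (m + 1))).congr_left fun z => ?_
    have h1 := congrArg (fun S => S.eval z) hR
    have h2 := congrArg (fun S => S.eval z) hPQ
    simp only [eval_mul, eval_pow, eval_X, eval_sub, eval_C] at h1 h2 ⊢
    rw [h2, pow_succ, mul_assoc, ← h1]
    ring

end HolJet

theorem eq_zero_of_isLittleO {c : ℂ} {m : ℕ}
    (h : (fun x : ℝ => c * (x : ℂ) ^ m) =o[𝓝[>] 0] fun x : ℝ => x ^ m) : c = 0 := by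
  have h1 : (fun _ : ℝ => c) =o[𝓝[>] 0] fun _ : ℝ => (1 : ℝ) := by
    rw [isLittleO_iff] at h ⊢
    intro ε hε
    filter_upwards [h hε, self_mem_nhdsWithin] with x hx (hx0 : 0 < x)
    rw [norm_mul, norm_pow, norm_pow, Complex.norm_real] at hx
    rw [norm_one, mul_one]
    exact le_of_mul_le_mul_right hx (pow_pos (norm_pos_iff.2 hx0.ne') m)
  simpa using h1

theorem isLittleO_norm_pow_succ {E : Type*} [SeminormedAddCommGroup E] (m : ℕ) {l : Filter E}
    (hl : l ≤ 𝓝 0) : (fun z : E => ‖z‖ ^ (m + 1)) =o[l] fun z => ‖z‖ ^ m := by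
  have h1 : (fun z : E => ‖z‖) =o[l] fun _ => (1 : ℝ) := by
    rw [isLittleO_one_iff]
    have : Tendsto (fun z : E => ‖z‖) (𝓝 0) (𝓝 0) := by simpa using tendsto_norm_zero (E := E)
    exact this.mono_left hl
  simpa [pow_succ] using (isBigO_refl (fun z : E => ‖z‖ ^ m) l).mul_isLittleO h1

theorem isBigO_norm_pow_of_le {E : Type*} [SeminormedAddCommGroup E] {j k : ℕ} (hjk : k ≤ j) :
    (fun z : E => ‖z‖ ^ j) =O[𝓝 0] fun z => ‖z‖ ^ k := by
  refine IsBigO.of_bound 1 ?_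
  filter_upwards [Metric.closedBall_mem_nhds (0 : E) one_pos] with z hz
  have hz' : ‖z‖ ≤ 1 := by simpa using hz
  rw [one_mul, norm_pow, norm_pow, norm_norm]
  exact pow_le_pow_of_le_one (norm_nonneg z) hz' hjk

theorem tendsto_ofReal_nhdsGT : Tendsto (fun x : ℝ => (x : ℂ)) (𝓝[>] 0) (𝓝 0) := by
  have : Tendsto (fun x : ℝ => (x : ℂ)) (𝓝 0) (𝓝 ((0 : ℝ) : ℂ)) :=
    Complex.continuous_ofReal.tendsto 0
  simpa using this.mono_left nhdsWithin_le_nhds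

theorem isLittleO_norm_ofReal {f : ℝ → ℂ} {m : ℕ} {l : Filter ℝ}
    (h : f =o[l] fun x : ℝ => ‖(x : ℂ)‖ ^ m) : f =o[l] fun x : ℝ => x ^ m := by
  refine h.trans_isBigO (IsBigO.of_bound 1 (Eventually.of_forall fun x => ?_))
  simp

/-- A leading term of degree below `N` would contradict the bound along the positive reals. The
constant may be `0`. -/
theorem HolJet.exists_sub_isBigO {f : ℂ → ℂ} (hf : HolJet f) {N : ℕ}
    (h : f =O[𝓝 0] fun z => ‖z‖ ^ N) :
    ∃ c : ℂ, (fun z => f z - c * z ^ N) =O[𝓝 0] fun z => ‖z‖ ^ (N + 1) := by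
  rcases hf.isBigO_or (N + 1) with h1 | ⟨m, hm, c, hc, h1⟩
  · exact ⟨0, by simpa using h1⟩
  · rcases (Nat.lt_succ_iff.1 hm).lt_or_eq with hlt | rfl
    · refine absurd (eq_zero_of_isLittleO (m := m) ?_) hc
      have h2 : (fun z : ℂ => c * z ^ m) =o[𝓝 0] fun z => ‖z‖ ^ m := by
        have h3 := (h.trans (isBigO_norm_pow_of_le (E := ℂ) hlt)).sub h1
        simp only [sub_sub_cancel] at h3
        exact h3.trans_isLittleO (isLittleO_norm_pow_succ m le_rfl)
      exact isLittleO_norm_ofReal (h2.comp_tendsto tendsto_ofReal_nhdsGT)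
    · exact ⟨c, h1⟩

/-- A smooth curve with holomorphic jets is, to any order, a graph `Y = g(X)` over a coordinate `X`
with nonzero derivative. -/
theorem HolJet.exists_polynomial_comp {X Y : ℂ → ℂ} (hX : HolJet X) (hY : HolJet Y) {a : ℂ}
    (ha : a ≠ 0) (hXa : IsEquivalent (𝓝 0) X fun z => a * z) (N : ℕ) :
    ∃ g : ℂ[X], (fun z => Y z - g.eval (X z)) =O[𝓝 0] fun z => ‖z‖ ^ N := by
  induction N with
  | zero => exact ⟨0, by simpa using hY.isBigO_one⟩
  | succ N ih =>
    obtain ⟨g, hg⟩ := ih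
    have hjet := hY.sub (hX.eval_comp g)
    obtain ⟨c, hc⟩ := hjet.exists_sub_isBigO hg
    -- As `X ~ a z`, this term cancels the leading term `c z ^ N` of the remainder up to `o(|z| ^
    -- N)`; the jet of the new remainder then improves this to `O(|z| ^ (N + 1))`.
    refine ⟨g + C (c / a ^ N) * Polynomial.X ^ N, ?_⟩
    have hjet' := hY.sub (hX.eval_comp (g + C (c / a ^ N) * Polynomial.X ^ N))
    have haN : a ^ N ≠ 0 := pow_ne_zero _ ha
    have hpow : (fun z => X z ^ N - (a * z) ^ N) =o[𝓝 0] fun z => ‖z‖ ^ N := by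
      refine (hXa.pow N).isLittleO.trans_isBigO (IsBigO.of_bound (‖a‖ ^ N) ?_)
      simp [mul_pow]
    have ho : (fun z => Y z - (g + C (c / a ^ N) * Polynomial.X ^ N).eval (X z)) =o[𝓝 0]
        fun z => ‖z‖ ^ N := by
      refine ((hc.trans_isLittleO (isLittleO_norm_pow_succ N le_rfl)).sub
        (hpow.const_mul_left (c / a ^ N))).congr_left fun z => ?_
      simp only [eval_add, eval_mul, eval_C, eval_pow, eval_X, mul_pow]
      field_simp
      ring
    obtain ⟨b, hb⟩ := hjet'.exists_sub_isBigO ho.isBigO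
    have hb0 : b = 0 := by
      refine eq_zero_of_isLittleO (m := N) (isLittleO_norm_ofReal ?_)
      have h3 := ho.sub (hb.trans_isLittleO (isLittleO_norm_pow_succ N le_rfl))
      simp only [sub_sub_cancel] at h3
      exact h3.comp_tendsto tendsto_ofReal_nhdsGT
    simpa [hb0] using hb

/-! ### Behaviour of analytic half-disks at the edge -/

theorem nhdsWithin_upperHalfDisk : 𝓝[upperHalfDisk] (0 : ℂ) = 𝓝[{z : ℂ | 0 ≤ z.im}] 0 := by
  have h : upperHalfDisk = {z : ℂ | 0 ≤ z.im} ∩ Metric.ball 0 1 := by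
    ext z
    simp [upperHalfDisk, and_comm]
  rw [h, nhdsWithin_inter_of_mem' (mem_nhdsWithin_of_mem_nhds (Metric.ball_mem_nhds 0 one_pos))]

theorem zero_mem_upperHalfDisk : (0 : ℂ) ∈ upperHalfDisk := by simp [upperHalfDisk]

theorem fderiv_I_eq_of_differentiableAt {F : Type*} [NormedAddCommGroup F] [NormedSpace ℂ F]
    {v : ℂ → F} {z : ℂ} (h : DifferentiableAt ℂ v z) :
    fderiv ℝ v z Complex.I = Complex.I • fderiv ℝ v z 1 := by
  rw [h.fderiv_restrictScalars ℝ]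
  simp only [ContinuousLinearMap.coe_restrictScalars']
  rw [← map_smul, smul_eq_mul, mul_one]

section Extension

variable {u v : ℂ → ℂ × ℂ}

theorem IsSmoothExtensionAt.eq_zero (hv : IsSmoothExtensionAt u v 0) : v 0 = u 0 :=
  hv.2.self_of_nhdsWithin zero_mem_upperHalfDisk

/-- The equations hold in the open half-disk by holomorphy and pass to the edge because the
differential of the extension is continuous. -/
theorem IsSmoothExtensionAt.eventually_cauchyRiemann (hu : IsAnalyticHalfDisk u)
    (hv : IsSmoothExtensionAt u v 0) : ∀ᶠ z in 𝓝[{z : ℂ | 0 ≤ z.im}] 0,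
      fderiv ℝ v z Complex.I = Complex.I • fderiv ℝ v z 1 := by
  obtain ⟨hs, he⟩ := hv
  rw [nhdsWithin_upperHalfDisk] at he
  obtain ⟨ε, hε, hball⟩ := exists_ball_halfPlane he
  have hs' : ∀ᶠ z in 𝓝 (0 : ℂ), ContDiffAt ℝ ∞ v z := hs
  obtain ⟨ε', hε', hball'⟩ := Metric.nhds_basis_ball.eventually_iff.1 hs'
  set ρ := min 1 (min ε ε') with hρ
  have hρ0 : 0 < ρ := lt_min one_pos (lt_min hε hε')
  refine eventually_halfPlane_of_ball hρ0 fun z hz hz0 => ?_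
  have hsub1 : Metric.ball (0 : ℂ) ρ ⊆ Metric.ball 0 1 := Metric.ball_subset_ball (min_le_left _ _)
  have hsub2 : Metric.ball (0 : ℂ) ρ ⊆ Metric.ball 0 ε :=
    Metric.ball_subset_ball ((min_le_right _ _).trans (min_le_left _ _))
  have hsub3 : Metric.ball (0 : ℂ) ρ ⊆ Metric.ball 0 ε' :=
    Metric.ball_subset_ball ((min_le_right _ _).trans (min_le_right _ _))
  have hcont : ContinuousOn (fderiv ℝ v) (Metric.ball 0 ρ) := fun w hw =>
    ((hball' (hsub3 hw)).fderiv_right (m := 0) (by simp)).continuousAt.continuousWithinAt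
  have hopen : IsOpen {w : ℂ | 0 < w.im} := isOpen_lt continuous_const Complex.continuous_im
  have hEq : Set.EqOn (fun w => fderiv ℝ v w Complex.I) (fun w => Complex.I • fderiv ℝ v w 1)
      (Metric.ball 0 ρ ∩ {w | 0 < w.im}) := fun w hw => by
    have hnhds : Metric.ball (0 : ℂ) ρ ∩ {w | 0 < w.im} ∈ 𝓝 w :=
      (Metric.isOpen_ball.inter hopen).mem_nhds hw
    have hint : w ∈ interior upperHalfDisk := by
      rw [mem_interior_iff_mem_nhds]
      refine mem_of_superset hnhds fun y hy => ⟨?_, le_of_lt hy.2⟩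
      exact mem_ball_zero_iff.1 (hsub1 hy.1)
    refine fderiv_I_eq_of_differentiableAt ?_
    have hd := (hu.holomorphic w hint).differentiableAt (isOpen_interior.mem_nhds hint)
    refine hd.congr_of_eventuallyEq ?_
    filter_upwards [hnhds] with y hy
    exact hball y (hsub2 hy.1) (le_of_lt hy.2)
  refine hEq.of_subset_closure (t := Metric.ball 0 ρ ∩ {w | 0 ≤ w.im}) ?_ ?_ ?_ ?_
    (show z ∈ Metric.ball 0 ρ ∩ {w : ℂ | 0 ≤ w.im} from ⟨hz, hz0⟩)
  · exact (hcont.clm_apply continuousOn_const).mono Set.inter_subset_left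
  · exact ((hcont.clm_apply continuousOn_const).mono Set.inter_subset_left).const_smul Complex.I
  · exact Set.inter_subset_inter_right _ fun w (hw : 0 < w.im) => hw.le
  · rw [← Complex.closure_setOfPred_lt_im]
    exact Metric.isOpen_ball.inter_closure

theorem IsSmoothExtensionAt.holJet_comp (hu : IsAnalyticHalfDisk u)
    (hv : IsSmoothExtensionAt u v 0) (α : ℂ × ℂ →L[ℂ] ℂ) : HolJet fun z => α (v z) := by
  have hα : ∀ z, DifferentiableAt ℝ v z →
      fderiv ℝ (fun z => α (v z)) z = (α.restrictScalars ℝ).comp (fderiv ℝ v z) := fun z hz =>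
    ((α.restrictScalars ℝ).hasFDerivAt.comp z hz.hasFDerivAt).fderiv
  refine holJet_of_smoothNear ?_ ?_
  · exact Eventually.mono hv.1 fun z hz => (α.restrictScalars ℝ).contDiff.contDiffAt.comp z hz
  · filter_upwards [hv.eventually_cauchyRiemann hu,
      hv.1.eventually_differentiableAt.filter_mono nhdsWithin_le_nhds] with z hz hd
    rw [hα z hd]
    simp [hz]

theorem IsSmoothExtensionAt.fderiv_apply (hu : IsAnalyticHalfDisk u)
    (hv : IsSmoothExtensionAt u v 0) (h : ℂ) : fderiv ℝ v 0 h = h • fderiv ℝ v 0 1 := by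
  have hI := (hv.eventually_cauchyRiemann hu).self_of_nhdsWithin (by simp)
  have h1 : h = h.re • (1 : ℂ) + h.im • Complex.I := by simp [Complex.re_add_im]
  conv_lhs => rw [h1]
  rw [map_add, map_smul, map_smul, hI]
  conv_rhs => rw [← Complex.re_add_im h]
  rw [add_smul, mul_smul, Complex.coe_smul, Complex.coe_smul]

theorem IsSmoothExtensionAt.fderivWithin_eq (hv : IsSmoothExtensionAt u v 0) :
    fderivWithin ℝ u upperHalfDisk 0 = fderiv ℝ v 0 := by
  have huniq : UniqueDiffWithinAt ℝ upperHalfDisk 0 :=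
    (uniqueDiffOn_halfPlane 0 (by simp)).mono_nhds nhdsWithin_upperHalfDisk.ge
  rw [← hv.1.differentiableAt.fderivWithin huniq]
  have h : v =ᶠ[𝓝[upperHalfDisk] 0] u := hv.2
  exact h.symm.fderivWithin_eq hv.eq_zero.symm

theorem IsSmoothExtensionAt.fderiv_ne_zero (hu : IsAnalyticHalfDisk u)
    (hv : IsSmoothExtensionAt u v 0) : fderiv ℝ v 0 1 ≠ 0 := fun h => by
  have hinj := hu.immersion 0 zero_mem_upperHalfDisk
  rw [hv.fderivWithin_eq] at hinj
  exact one_ne_zero (hinj (h.trans (map_zero _).symm))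

/-- Two extensions agree on the half-disk, so their difference is flat. This makes later expansions
independent of the extension. -/
theorem IsSmoothExtensionAt.sub_isBigO {v' : ℂ → ℂ × ℂ} (hv : IsSmoothExtensionAt u v 0)
    (hv' : IsSmoothExtensionAt u v' 0) (N : ℕ) :
    (fun z => v' z - v z) =O[𝓝 0] fun z => ‖z‖ ^ N := by
  refine isBigO_of_eq_zero_halfPlane N ?_ ?_
  · have h1 := hv.1
    have h2 := hv'.1
    unfold SmoothNear at h1 h2 ⊢
    filter_upwards [h1, h2] with z hz hz'
    exact hz'.sub hz
  · rw [← nhdsWithin_upperHalfDisk]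
    filter_upwards [hv.2, hv'.2] with z hz hz'
    rw [hz, hz', sub_self]

end Extension

/-! ### Defining functions and the leading term of a graph form -/

/-- `Φ` is, to order `N`, a defining function of the complex curve `v` at `0`, with differential
`μ`, and `ℓ` is a linear coordinate along the curve. -/
structure IsDefiningFunction (v : ℂ → ℂ × ℂ) (N : ℕ) (Φ : ℂ × ℂ → ℂ) (μ ℓ : ℂ × ℂ →L[ℂ] ℂ) :
    Prop where
  strict : HasStrictFDerivAt Φ μ (v 0)
  vanish : (fun z => Φ (v z)) =O[𝓝 0] fun z => ‖z‖ ^ N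
  holJet : ∀ w : ℂ → ℂ × ℂ, (∀ α : ℂ × ℂ →L[ℂ] ℂ, HolJet fun z => α (w z)) → HolJet fun z => Φ (w z)
  normal : μ (fderiv ℝ v 0 1) = 0
  tangent : ℓ (fderiv ℝ v 0 1) = 1
  injective : ∀ q, ℓ q = 0 → μ q = 0 → q = 0

theorem exists_isDefiningFunction {v : ℂ → ℂ × ℂ} (hv : DifferentiableAt ℝ v 0)
    (hjet : ∀ α : ℂ × ℂ →L[ℂ] ℂ, HolJet fun z => α (v z))
    (hlin : ∀ h, fderiv ℝ v 0 h = h • fderiv ℝ v 0 1) (hne : fderiv ℝ v 0 1 ≠ 0) {N : ℕ}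
    (hN : 2 ≤ N) : ∃ Φ μ ℓ, IsDefiningFunction v N Φ μ ℓ := by
  set a := fderiv ℝ v 0 1 with ha
  -- The coordinates of `ℂ²` are ordered so that `β` is a parameter along the curve; then `Φ = α -
  -- g(β - β(v 0))`.
  obtain ⟨α, β, hβ, hαβ⟩ : ∃ α β : ℂ × ℂ →L[ℂ] ℂ, β a ≠ 0 ∧ ∀ q, α q = 0 → β q = 0 → q = 0 := by
    by_cases h1 : a.1 = 0
    · refine ⟨ContinuousLinearMap.fst ℂ ℂ ℂ, ContinuousLinearMap.snd ℂ ℂ ℂ, fun h2 => hne ?_,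
        fun q h h' => Prod.ext h h'⟩
      exact Prod.ext h1 h2
    · exact ⟨ContinuousLinearMap.snd ℂ ℂ ℂ, ContinuousLinearMap.fst ℂ ℂ ℂ, h1,
        fun q h h' => Prod.ext h' h⟩
  have hX : HolJet fun z => β (v z) - β (v 0) := by
    simpa using (hjet β).sub (HolJet.polynomial (C (β (v 0))))
  have hXa : IsEquivalent (𝓝 0) (fun z => β (v z) - β (v 0)) fun z => β a * z := by
    have h1 := ((β.restrictScalars ℝ).hasFDerivAt.comp 0 hv.hasFDerivAt).isLittleO
    have h2 : (fun z : ℂ => z) =O[𝓝 0] fun z => β a * z :=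
      IsBigO.of_bound ‖β a‖⁻¹ (Eventually.of_forall fun z => by
        rw [norm_mul, inv_mul_cancel_left₀ (norm_ne_zero_iff.2 hβ)])
    refine (IsLittleO.trans_isBigO (h1.congr_left fun z => ?_) (by simpa using h2) :)
    simp [hlin z, mul_comm]
  obtain ⟨g, hg⟩ := hX.exists_polynomial_comp (hjet α) hβ hXa N
  set μ : ℂ × ℂ →L[ℂ] ℂ := α - (derivative g).eval 0 • β with hμ
  have hstrict : HasStrictFDerivAt (fun q => α q - g.eval (β q - β (v 0))) μ (v 0) := by
    have h1 : HasStrictFDerivAt (fun q => β q - β (v 0)) β (v 0) :=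
      β.hasStrictFDerivAt.sub_const _
    have h2 : HasStrictDerivAt (fun x => g.eval x) ((derivative g).eval 0) (β (v 0) - β (v 0)) := by
      rw [sub_self]
      exact g.hasStrictDerivAt 0
    have h3 : HasStrictFDerivAt (fun q => g.eval (β q - β (v 0))) ((derivative g).eval 0 • β) (v 0) :=
      HasStrictDerivAt.comp_hasStrictFDerivAt (h₂ := fun x => g.eval x)
        (f := fun q => β q - β (v 0)) (v 0) h2 h1
    exact α.hasStrictFDerivAt.sub h3
  refine ⟨fun q => α q - g.eval (β q - β (v 0)), μ, (β a)⁻¹ • β, hstrict, hg, ?_, ?_, ?_, ?_⟩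
  · intro w hw
    refine (hw α).sub (HolJet.eval_comp ?_ g)
    simpa using (hw β).sub (HolJet.polynomial (C (β (v 0))))
  · have h1 := (hstrict.hasFDerivAt.restrictScalars ℝ).comp 0 hv.hasFDerivAt
    have h2 : HasFDerivAt (fun z => α (v z) - g.eval (β (v z) - β (v 0))) (0 : ℂ →L[ℝ] ℂ) 0 := by
      -- Vanishing to order at least `2` along the curve forces the differential of `Φ` to kill its
      -- tangent.
      have h3 := hg.trans (isBigO_norm_pow_of_le hN)
      have h4 : α (v 0) - g.eval 0 = 0 := by
        obtain ⟨B, hB⟩ := h3.bound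
        simpa using hB.self_of_nhds
      refine .of_isLittleO ?_
      have h5 := h3.trans_isLittleO (isLittleO_norm_pow_succ (E := ℂ) 1 le_rfl)
      simp only [pow_one] at h5
      exact h5.of_norm_right.congr (fun z => by simp [h4, sub_self]) fun z => by simp
    have h3 := congrArg (fun T : ℂ →L[ℝ] ℂ => T 1) (h1.unique h2)
    simpa using h3
  · simp [← ha, hβ]
  · intro q hq hq'
    have h1 : β q = 0 := by simpa [hβ] using hq
    refine hαβ q ?_ h1
    simpa [hμ, h1] using hq'

/-- An error term that involves the unknown `f` itself is absorbed: it first gives `f = O(h)`. -/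
theorem isLittleO_of_isLittleO_add {E F : Type*} [NormedAddCommGroup E] {l : Filter F} {f g : F → E}
    {h : F → ℝ} (hfg : (fun x => f x - g x) =o[l] fun x => ‖f x‖ + ‖h x‖) (hg : g =O[l] h) :
    (fun x => f x - g x) =o[l] h := by
  have hf : f =O[l] h := by
    obtain ⟨B, hB⟩ := hg.bound
    refine IsBigO.of_bound (2 * B + 1) ?_
    filter_upwards [hB, hfg.def (half_pos one_pos)] with x h1 h2
    rw [Real.norm_of_nonneg (by positivity : (0 : ℝ) ≤ ‖f x‖ + ‖h x‖)] at h2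
    have h3 : ‖f x‖ ≤ ‖f x - g x‖ + ‖g x‖ := by simpa using norm_add_le (f x - g x) (g x)
    linarith
  exact hfg.trans_isBigO (hf.norm_left.add (isBigO_refl h l).norm_left)

theorem exists_norm_le_mul_of_det_ne_zero {A : ℂ →L[ℝ] ℂ} (hA : LinearMap.det (A : ℂ →ₗ[ℝ] ℂ) ≠ 0) :
    ∃ K > 0, ∀ z, ‖z‖ ≤ K * ‖A z‖ := by
  let e := (LinearMap.equivOfDetNeZero (A : ℂ →ₗ[ℝ] ℂ) hA).toContinuousLinearEquiv
  refine ⟨‖(e.symm : ℂ →L[ℝ] ℂ)‖ + 1, by positivity, fun z => ?_⟩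
  have h1 : e.symm (A z) = z := e.symm_apply_apply z
  have h2 := (e.symm : ℂ →L[ℝ] ℂ).le_opNorm (A z)
  rw [ContinuousLinearEquiv.coe_coe, h1] at h2
  nlinarith [norm_nonneg (A z)]

/-- The condition on a real linear map of `ℂ` to fix the direction of the real axis and the side
of the upper half-plane. -/
structure KeepsHalfPlane (A : ℂ →L[ℝ] ℂ) : Prop where
  re_one : 0 < (A 1).re
  im_one : (A 1).im = 0
  im_I : 0 < (A Complex.I).im

theorem KeepsHalfPlane.det_pos {A : ℂ →L[ℝ] ℂ} (hA : KeepsHalfPlane A) :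
    0 < LinearMap.det (A : ℂ →ₗ[ℝ] ℂ) := by
  rw [det_complex]
  simp only [ContinuousLinearMap.coe_coe, hA.im_one, mul_zero, sub_zero]
  exact mul_pos hA.re_one hA.im_I

theorem IsEdgeChange.keepsHalfPlane {η : ℂ → ℂ} (hη : IsEdgeChange η) :
    KeepsHalfPlane (fderiv ℝ η 0) := ⟨hη.tangent_re, hη.tangent_im, hη.inward⟩

theorem IsEdgeChange.isEquivalent {η : ℂ → ℂ} (hη : IsEdgeChange η) :
    IsEquivalent (𝓝 0) η (fderiv ℝ η 0) := by
  obtain ⟨K, hK, hb⟩ := exists_norm_le_mul_of_det_ne_zero hη.keepsHalfPlane.det_pos.ne'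
  have h1 := hη.smooth.differentiableAt.hasFDerivAt.isLittleO
  have h2 : (fun z : ℂ => z) =O[𝓝 0] fderiv ℝ η 0 := IsBigO.of_bound K (Eventually.of_forall hb)
  refine (IsLittleO.trans_isBigO (h1.congr_left fun z => ?_) (by simpa using h2) :)
  simp [hη.zero]

theorem IsEdgeChange.tendsto {η : ℂ → ℂ} (hη : IsEdgeChange η) : Tendsto η (𝓝 0) (𝓝 0) := by
  have := hη.smooth.contDiffAt.continuousAt.tendsto
  rwa [hη.zero] at this

theorem IsEdgeChange.isBigO {η : ℂ → ℂ} (hη : IsEdgeChange η) : η =O[𝓝 0] fun z => ‖z‖ :=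
  (hη.isEquivalent.isBigO.trans ((fderiv ℝ η 0).isBigO_id _)).norm_right

theorem IsEdgeChange.comp_sub_isLittleO {η : ℂ → ℂ} (hη : IsEdgeChange η) {f : ℂ → ℂ} {c : ℂ}
    {m : ℕ} (hf : (fun z => f z - c * z ^ m) =O[𝓝 0] fun z => ‖z‖ ^ (m + 1)) :
    (fun z => f (η z) - c * fderiv ℝ η 0 z ^ m) =o[𝓝 0] fun z => ‖z‖ ^ m := by
  have h1 : (fun z => f (η z) - c * η z ^ m) =O[𝓝 0] fun z => ‖z‖ ^ (m + 1) :=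
    (hf.comp_tendsto hη.tendsto).trans (hη.isBigO.norm_left.pow (m + 1))
  have h2 : (fun z => η z ^ m - fderiv ℝ η 0 z ^ m) =o[𝓝 0] fun z => ‖z‖ ^ m :=
    (hη.isEquivalent.pow m).isLittleO.trans_isBigO
      ((((fderiv ℝ η 0).isBigO_id (𝓝 0)).norm_right.pow m))
  refine ((h1.trans_isLittleO (isLittleO_norm_pow_succ m le_rfl)).add
    (h2.const_mul_left c)).congr_left fun z => ?_
  ring

theorem tendsto_mul_sign (σ : ℝ) :
    Tendsto (fun w : ℂ => (σ : ℂ) * w) (𝓝[{w : ℂ | 0 ≤ σ * w.im}] 0) (𝓝[{z : ℂ | 0 ≤ z.im}] 0) := by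
  refine tendsto_nhdsWithin_iff.2 ⟨?_, ?_⟩
  · have : Tendsto (fun w : ℂ => (σ : ℂ) * w) (𝓝 0) (𝓝 ((σ : ℂ) * 0)) := by
      exact (continuous_const.mul continuous_id).tendsto 0
    rw [mul_zero] at this
    exact this.mono_left nhdsWithin_le_nhds
  · filter_upwards [self_mem_nhdsWithin] with w hw
    simpa using hw

theorem sign_mul_self {σ : ℝ} (hσ : σ = 1 ∨ σ = -1) : (σ : ℂ) * σ = 1 := by
  rcases hσ with rfl | rfl <;> simp

/-- A real linear automorphism of `ℂ²` which preserves orientation and carries the complex line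
`ℂ a` to `ℂ × 0` by an orientation preserving map carries its complex normal to `0 × ℂ`
in an orientation preserving way. -/
theorem det_normal_pos {T : (ℂ × ℂ) ≃L[ℝ] ℂ × ℂ} (hT : 0 < LinearMap.det (T : ℂ × ℂ →ₗ[ℝ] ℂ × ℂ))
    {a : ℂ × ℂ} {B : ℂ →L[ℝ] ℂ} (hB : 0 < LinearMap.det (B : ℂ →ₗ[ℝ] ℂ))
    (hTB : ∀ z, T (B z • a) = (z, 0)) {μ ℓ : ℂ × ℂ →L[ℂ] ℂ} (hμ : μ a = 0) (hℓ : ℓ a = 1)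
    (hinj : ∀ q, ℓ q = 0 → μ q = 0 → q = 0) {M : ℂ →L[ℝ] ℂ} (hM : ∀ t, M t = μ (T.symm (0, t))) :
    0 < LinearMap.det (M : ℂ →ₗ[ℝ] ℂ) := by
  set Λ : ℂ × ℂ →ₗ[ℂ] ℂ × ℂ := (ℓ : ℂ × ℂ →ₗ[ℂ] ℂ).prod (μ : ℂ × ℂ →ₗ[ℂ] ℂ) with hΛ
  have hΛdet : LinearMap.det Λ ≠ 0 := by
    have hker : LinearMap.ker Λ = ⊥ := by
      rw [LinearMap.ker_eq_bot']
      intro q hq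
      exact hinj q (congrArg Prod.fst hq) (congrArg Prod.snd hq)
    exact (LinearMap.isUnit_iff_isUnit_det Λ).1 ((LinearMap.isUnit_iff_ker_eq_bot Λ).2 hker) |>.ne_zero
  -- A complex linear automorphism has real determinant `|det|² > 0`. Below, `Λ ∘ T⁻¹` is block
  -- triangular with diagonal blocks `B` and `M`.
  have hΛR : 0 < LinearMap.det (Λ.restrictScalars ℝ) := by
    rw [LinearMap.det_restrictScalars, Algebra.norm_complex_apply]
    exact Complex.normSq_pos.2 hΛdet
  have hTsymm : 0 < LinearMap.det (T.symm : ℂ × ℂ →ₗ[ℝ] ℂ × ℂ) := by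
    have h1 : LinearMap.det (T.symm : ℂ × ℂ →ₗ[ℝ] ℂ × ℂ) *
        LinearMap.det (T : ℂ × ℂ →ₗ[ℝ] ℂ × ℂ) = 1 := by
      rw [← LinearMap.det_comp]
      have : (T.symm : ℂ × ℂ →ₗ[ℝ] ℂ × ℂ) ∘ₗ (T : ℂ × ℂ →ₗ[ℝ] ℂ × ℂ) = LinearMap.id := by
        ext q <;> simp
      rw [this, LinearMap.det_id]
    exact pos_of_mul_pos_left (h1 ▸ one_pos) hT.le
  have hprod := det_of_triangular (Λ.restrictScalars ℝ ∘ₗ (T.symm : ℂ × ℂ →ₗ[ℝ] ℂ × ℂ))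
    (B : ℂ →ₗ[ℝ] ℂ) (M : ℂ →ₗ[ℝ] ℂ) (fun z => ?_) (fun t => ?_)
  · rw [LinearMap.det_comp] at hprod
    have h1 := mul_pos hΛR hTsymm
    rw [hprod] at h1
    exact pos_of_mul_pos_right h1 hB.le
  · have h1 : T.symm (z, 0) = B z • a := by rw [← hTB z, T.symm_apply_apply]
    simp [hΛ, h1, hμ, hℓ]
  · simp [hΛ, hM]

variable {v₁ v₂ : ℂ → ℂ × ℂ} {η₁ η₂ : ℂ → ℂ} {Ψ : ℂ × ℂ → ℂ × ℂ} {σ : ℝ} {φ : ℂ → ℂ}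

/-- The leading term of the function `φ` of a graph form, in terms of a defining function `Φ` of the
first curve. -/
theorem graph_sub_isLittleO (hσ : σ = 1 ∨ σ = -1) (hv₁ : SmoothNear v₁ 0) (hv₂ : SmoothNear v₂ 0)
    (h12 : v₂ 0 = v₁ 0) (hlin : ∀ h, fderiv ℝ v₁ 0 h = h • fderiv ℝ v₁ 0 1)
    (hη₁ : IsEdgeChange η₁) (hη₂ : IsEdgeChange η₂) (hΨ : SmoothNear Ψ (v₁ 0)) (hΨ0 : Ψ (v₁ 0) = 0)
    (hdet : 0 < (fderiv ℝ Ψ (v₁ 0)).det)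
    (hgraph : ∀ᶠ z in 𝓝[{z : ℂ | 0 ≤ z.im}] (0 : ℂ),
      Ψ (v₁ (η₁ z)) = (z, 0) ∧ Ψ (v₂ (η₂ z)) = (σ * z, φ (σ * z)))
    {N : ℕ} {Φ : ℂ × ℂ → ℂ} {μ ℓ : ℂ × ℂ →L[ℂ] ℂ}
    (hΦ : IsDefiningFunction v₁ N Φ μ ℓ) :
    ∃ L A : ℂ →L[ℝ] ℂ, 0 < LinearMap.det (L : ℂ →ₗ[ℝ] ℂ) ∧ KeepsHalfPlane A ∧
      ∀ (m : ℕ) (c : ℂ), m < N →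
        (fun z => Φ (v₂ z) - c * z ^ m) =O[𝓝 0] (fun z => ‖z‖ ^ (m + 1)) →
        (fun w => φ w - L (c * σ ^ m * A w ^ m)) =o[𝓝[{w : ℂ | 0 ≤ σ * w.im}] 0]
          fun w => ‖w‖ ^ m := by
  set p := v₁ 0 with hp
  set a := fderiv ℝ v₁ 0 1 with ha
  set T : (ℂ × ℂ) ≃L[ℝ] ℂ × ℂ := (fderiv ℝ Ψ p).toContinuousLinearEquivOfDetNeZero hdet.ne' with hT
  have hTcoe : (T : ℂ × ℂ →L[ℝ] ℂ × ℂ) = fderiv ℝ Ψ p :=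
    ContinuousLinearMap.coe_toContinuousLinearEquivOfDetNeZero _ _
  have hΨs : HasStrictFDerivAt Ψ (T : ℂ × ℂ →L[ℝ] ℂ × ℂ) p := by
    rw [hTcoe]; exact hΨ.hasStrictFDerivAt
  have hη₁0 : v₁ (η₁ 0) = p := by rw [hη₁.zero]
  have hη₂0 : v₂ (η₂ 0) = p := by rw [hη₂.zero, h12]
  have hq₁ : SmoothNear (fun z => v₁ (η₁ z)) 0 := SmoothNear.comp (by rwa [hη₁.zero]) hη₁.smooth
  have hq₂ : SmoothNear (fun z => v₂ (η₂ z)) 0 := SmoothNear.comp (by rwa [hη₂.zero]) hη₂.smooth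
  have hΨq₁ : SmoothNear (fun z => Ψ (v₁ (η₁ z))) 0 := SmoothNear.comp (by rwa [hη₁0]) hq₁
  -- The flat form of the first half-disk is known for `Im z ≥ 0` only. When `σ = -1` the second one
  -- is a graph over the other side, and flatness carries the formula across.
  have hρ : ∀ k : ℕ, (fun w => Ψ (v₁ (η₁ w)) - (w, 0)) =O[𝓝 0] fun w => ‖w‖ ^ k := fun k => by
    refine isBigO_of_eq_zero_halfPlane k ?_ (hgraph.mono fun z hz => by rw [hz.1, sub_self])
    unfold SmoothNear at hΨq₁ ⊢
    filter_upwards [hΨq₁] with z hz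
    exact hz.sub (contDiff_id.prodMk contDiff_const).contDiffAt
  have hTB : ∀ z, T (fderiv ℝ η₁ 0 z • a) = (z, 0) := fun z => by
    have h1 : HasFDerivAt (fun z => v₁ (η₁ z)) ((fderiv ℝ v₁ 0).comp (fderiv ℝ η₁ 0)) 0 := by
      refine HasFDerivAt.comp (g := v₁) 0 ?_ hη₁.smooth.differentiableAt.hasFDerivAt
      rw [hη₁.zero]
      exact hv₁.differentiableAt.hasFDerivAt
    have h2 : HasFDerivAt (fun z => Ψ (v₁ (η₁ z)))
        ((T : ℂ × ℂ →L[ℝ] ℂ × ℂ).comp ((fderiv ℝ v₁ 0).comp (fderiv ℝ η₁ 0))) 0 := by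
      refine HasFDerivAt.comp (g := Ψ) 0 ?_ h1
      rw [hη₁0]
      exact hΨs.hasFDerivAt
    have h3 : HasFDerivAt (fun z => Ψ (v₁ (η₁ z))) (ContinuousLinearMap.inl ℝ ℂ ℂ) 0 := by
      refine .of_isLittleO ?_
      have h4 := ((hρ 2).trans_isLittleO (isLittleO_norm_pow_succ (E := ℂ) 1 le_rfl))
      simp only [pow_one] at h4
      refine h4.of_norm_right.congr (fun z => ?_) fun z => by simp
      simp [hη₁0, hΨ0]
    have h4 := congrArg (fun S : ℂ →L[ℝ] ℂ × ℂ => S z) (h2.unique h3)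
    simpa [hlin (fderiv ℝ η₁ 0 z), ← ha] using h4
  set S : ℂ × ℂ →L[ℝ] ℂ := (μ.restrictScalars ℝ).comp (T.symm : ℂ × ℂ →L[ℝ] ℂ × ℂ) with hS
  set M : ℂ →L[ℝ] ℂ := S.comp (ContinuousLinearMap.inr ℝ ℂ ℂ) with hM
  have hMdet : 0 < LinearMap.det (M : ℂ →ₗ[ℝ] ℂ) := by
    refine det_normal_pos (T := T) ?_ hη₁.keepsHalfPlane.det_pos hTB hΦ.normal hΦ.tangent
      hΦ.injective fun t => by simp [hM, hS]
    have : ((T : ℂ × ℂ →L[ℝ] ℂ × ℂ) : ℂ × ℂ →ₗ[ℝ] ℂ × ℂ) = (fderiv ℝ Ψ p : ℂ × ℂ →ₗ[ℝ] ℂ × ℂ) := by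
      rw [hTcoe]
    exact lt_of_lt_of_eq hdet (congrArg LinearMap.det this.symm)
  set Mi : ℂ ≃L[ℝ] ℂ := M.toContinuousLinearEquivOfDetNeZero hMdet.ne' with hMi
  have hMicoe : ∀ t, Mi t = M t := fun t =>
    congrArg (fun R : ℂ →L[ℝ] ℂ => R t)
      (ContinuousLinearMap.coe_toContinuousLinearEquivOfDetNeZero M hMdet.ne')
  have hLdet : 0 < LinearMap.det ((Mi.symm : ℂ →L[ℝ] ℂ) : ℂ →ₗ[ℝ] ℂ) := by
    have h1 : LinearMap.det ((Mi.symm : ℂ →L[ℝ] ℂ) : ℂ →ₗ[ℝ] ℂ) *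
        LinearMap.det (M : ℂ →ₗ[ℝ] ℂ) = 1 := by
      rw [← LinearMap.det_comp]
      have : ((Mi.symm : ℂ →L[ℝ] ℂ) : ℂ →ₗ[ℝ] ℂ) ∘ₗ (M : ℂ →ₗ[ℝ] ℂ) = LinearMap.id := by
        refine LinearMap.ext fun t => ?_
        simp [← hMicoe]
      rw [this, LinearMap.det_id]
    exact pos_of_mul_pos_left (h1 ▸ one_pos) hMdet.le
  refine ⟨Mi.symm, fderiv ℝ η₂ 0, hLdet, hη₂.keepsHalfPlane, fun m c hmN hc => ?_⟩
  set l := 𝓝[{w : ℂ | 0 ≤ σ * w.im}] (0 : ℂ) with hl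
  have hl0 : l ≤ 𝓝 0 := nhdsWithin_le_nhds
  have hσt : Tendsto (fun w : ℂ => (σ : ℂ) * w) l (𝓝 0) :=
    (tendsto_mul_sign σ).mono_right nhdsWithin_le_nhds
  have hgr : ∀ᶠ w in l, Ψ (v₂ (η₂ (σ * w))) = (w, φ w) := by
    filter_upwards [(tendsto_mul_sign σ).eventually hgraph] with w hw
    rw [hw.2, ← mul_assoc, sign_mul_self hσ, one_mul]
  have hc₁ : Tendsto (fun w => v₁ (η₁ w)) l (𝓝 p) := by
    have := hq₁.contDiffAt.continuousAt.tendsto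
    rw [hη₁0] at this
    exact this.mono_left hl0
  have hc₂ : Tendsto (fun w => v₂ (η₂ (σ * w))) l (𝓝 p) := by
    have := hq₂.contDiffAt.continuousAt.tendsto
    rw [hη₂0] at this
    exact this.comp hσt
  have hΨc : Tendsto Ψ (𝓝 p) (𝓝 (Ψ p)) := hΨ.contDiffAt.continuousAt.tendsto
  have hΘ : HasStrictFDerivAt (fun x => Φ (hΨs.localInverse Ψ T p x)) S (Ψ p) := by
    refine HasStrictFDerivAt.comp (g := Φ) (Ψ p) ?_ hΨs.to_localInverse
    have h1 : hΨs.localInverse Ψ T p (Ψ p) = p := hΨs.eventually_left_inverse.self_of_nhds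
    rw [h1]
    exact hΦ.strict.restrictScalars ℝ
  -- Strict differentiability of `Φ ∘ Ψ⁻¹` compares the graph point `(w, φ w)` with the nearby point
  -- of the first surface. The error is small relative to their difference, not to the distance from
  -- the origin.
  have hdiff : (fun w => Φ (v₂ (η₂ (σ * w))) - Φ (v₁ (η₁ w)) -
      S (Ψ (v₂ (η₂ (σ * w))) - Ψ (v₁ (η₁ w)))) =o[l]
      fun w => Ψ (v₂ (η₂ (σ * w))) - Ψ (v₁ (η₁ w)) := by
    have h1 := hΘ.isLittleO.comp_tendsto
      ((hΨc.comp hc₂).prodMk_nhds (hΨc.comp hc₁))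
    refine h1.congr' ?_ ?_
    · filter_upwards [hc₁.eventually hΨs.eventually_left_inverse,
        hc₂.eventually hΨs.eventually_left_inverse] with w hw hw'
      simp only [Function.comp_apply, hw, hw']
    · exact Eventually.of_forall fun w => rfl
  have hpw : (fun w : ℂ => ‖w‖ ^ N) =o[l] fun w : ℂ => ‖w‖ ^ m :=
    ((isBigO_norm_pow_of_le (E := ℂ) hmN).trans_isLittleO
      (isLittleO_norm_pow_succ m le_rfl)).mono hl0
  have hρN := ((hρ N).mono hl0).trans_isLittleO hpw
  have hΨdiff : ∀ᶠ w in l, Ψ (v₂ (η₂ (σ * w))) - Ψ (v₁ (η₁ w)) =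
      (0, φ w) - (Ψ (v₁ (η₁ w)) - (w, 0)) := hgr.mono fun w hw => by
    rw [hw]
    ext1 <;> simp
  have hle : (fun w : ℂ => ‖w‖ ^ m) =O[l] fun w => ‖φ w‖ + ‖‖w‖ ^ m‖ :=
    IsBigO.of_bound 1 (Eventually.of_forall fun w => by
      rw [one_mul, Real.norm_of_nonneg (by positivity : (0 : ℝ) ≤ ‖φ w‖ + ‖‖w‖ ^ m‖)]
      exact le_add_of_nonneg_left (norm_nonneg _))
  have hbd : (fun w => Ψ (v₂ (η₂ (σ * w))) - Ψ (v₁ (η₁ w))) =O[l]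
      fun w => ‖φ w‖ + ‖‖w‖ ^ m‖ := by
    have h1 : (fun w => ((0 : ℂ), φ w)) =O[l] fun w => ‖φ w‖ + ‖‖w‖ ^ m‖ :=
      IsBigO.of_bound 1 (Eventually.of_forall fun w => by
        rw [one_mul, Real.norm_of_nonneg (by positivity), Prod.norm_def, norm_zero,
          max_eq_right (norm_nonneg _)]
        exact le_add_of_nonneg_right (norm_nonneg _))
    refine (h1.sub (hρN.isBigO.trans hle)).congr' ?_ EventuallyEq.rfl
    exact hΨdiff.mono fun w hw => hw.symm
  have hE : (fun w => Φ (v₂ (η₂ (σ * w))) - c * (fderiv ℝ η₂ 0 (σ * w)) ^ m) =o[l]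
      fun w => ‖w‖ ^ m := by
    refine ((hη₂.comp_sub_isLittleO hc).comp_tendsto hσt).trans_isBigO
      (IsBigO.of_bound 1 (Eventually.of_forall fun w => ?_))
    have : |σ| = 1 := by rcases hσ with rfl | rfl <;> simp
    simp [this]
  have hV : (fun w => Φ (v₁ (η₁ w))) =o[l] fun w => ‖w‖ ^ m :=
    (((hΦ.vanish.comp_tendsto hη₁.tendsto).trans
      (hη₁.isBigO.norm_left.pow N)).mono hl0).trans_isLittleO hpw
  have hσA : ∀ w, fderiv ℝ η₂ 0 (σ * w) = σ * fderiv ℝ η₂ 0 w := fun w => by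
    rw [← Complex.real_smul, map_smul, Complex.real_smul]
  have hMφ : (fun w => M (φ w) - c * σ ^ m * fderiv ℝ η₂ 0 w ^ m) =o[l]
      fun w => ‖φ w‖ + ‖‖w‖ ^ m‖ := by
    have h1 : (fun w => S (Ψ (v₁ (η₁ w)) - (w, 0))) =o[l] fun w => ‖w‖ ^ m :=
      (S.isBigO_comp _ _).trans_isLittleO hρN
    have h2 := (((hE.sub hV).add h1).trans_isBigO hle).sub (hdiff.trans_isBigO hbd)
    refine h2.congr' ?_ EventuallyEq.rfl
    filter_upwards [hΨdiff] with w hw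
    rw [hw, S.map_sub (0, φ w), hσA, mul_pow]
    have h3 : S (0, φ w) = M (φ w) := by simp [hM]
    rw [h3]
    ring
  -- Inverting `M` solves for `φ`, so `L = M⁻¹`; the `‖φ‖` in the error is absorbed.
  refine isLittleO_of_isLittleO_add ?_ ?_
  · refine (((Mi.symm : ℂ →L[ℝ] ℂ).isBigO_comp _ _).trans_isLittleO hMφ).congr_left fun w => ?_
    rw [map_sub, ← hMicoe]
    simp
  · refine ((Mi.symm : ℂ →L[ℝ] ℂ).isBigO_comp _ _).trans ?_
    exact (((fderiv ℝ η₂ 0).isBigO_id l).norm_right.pow m).const_mul_left _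

/-! ### Reflection and the index of a reflected graph -/

theorem eq_ofReal_of_sign_mul_im_eq_zero {σ : ℝ} (hσ : σ ≠ 0) {w : ℂ} (h : σ * w.im = 0) :
    w = (w.re : ℂ) :=
  Complex.ext rfl (by simpa using (mul_eq_zero.1 h).resolve_left hσ)

theorem reflect_of_nonneg {σ : ℝ} {f : ℂ → ℂ} {w : ℂ} (h : 0 ≤ σ * w.im) : reflect σ f w = f w :=
  if_pos h

theorem reflect_of_nonpos {σ : ℝ} (hσ : σ ≠ 0) {f : ℂ → ℂ} {w : ℂ} (h : σ * w.im ≤ 0)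
    (hreal : ∀ x : ℝ, (x : ℂ) = w → (f x).im = 0) : reflect σ f w = conj (f (conj w)) := by
  rcases h.lt_or_eq with hlt | heq
  · exact if_neg (not_le.2 hlt)
  · have hw := eq_ofReal_of_sign_mul_im_eq_zero hσ heq
    rw [reflect_of_nonneg heq.ge]
    have hc : conj w = w := Complex.conj_eq_iff_im.2 (by rw [hw, Complex.ofReal_im])
    rw [hc, Complex.conj_eq_iff_im.2]
    rw [hw]
    exact hreal _ hw.symm

theorem continuousOn_reflect {σ : ℝ} (hσ : σ ≠ 0) {f : ℂ → ℂ} {S : Set ℂ} (hS : IsClosed S)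
    (hconj : ∀ w ∈ S, conj w ∈ S) (hf : ContinuousOn f (S ∩ {w | 0 ≤ σ * w.im}))
    (hreal : ∀ x : ℝ, (x : ℂ) ∈ S → (f x).im = 0) : ContinuousOn (reflect σ f) S := by
  have hcl : ∀ τ : ℝ, IsClosed {w : ℂ | 0 ≤ τ * w.im} := fun τ =>
    isClosed_le continuous_const (continuous_const.mul Complex.continuous_im)
  have hcover : S ⊆ (S ∩ {w | 0 ≤ σ * w.im}) ∪ (S ∩ {w | 0 ≤ -σ * w.im}) := fun w hw => by
    rcases le_total 0 (σ * w.im) with h | h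
    · exact Or.inl ⟨hw, h⟩
    · exact Or.inr ⟨hw, by simpa using h⟩
  refine (ContinuousOn.union_of_isClosed ?_ ?_ (hS.inter (hcl σ)) (hS.inter (hcl (-σ)))).mono hcover
  · exact hf.congr fun w hw => reflect_of_nonneg hw.2
  · refine ContinuousOn.congr (f := fun w => conj (f (conj w))) ?_ fun w hw =>
      reflect_of_nonpos hσ (by simpa using hw.2) fun x hx => hreal x (hx ▸ hw.1)
    refine Complex.continuous_conj.comp_continuousOn
      (hf.comp Complex.continuous_conj.continuousOn fun w hw => ⟨hconj w hw.1, ?_⟩)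
    simpa using hw.2

/-- A real linear map of `ℂ` which fixes the real axis pointwise and preserves the upper
half-plane. -/
structure FixesRealAxis (B : ℂ →L[ℝ] ℂ) : Prop where
  map_one : B 1 = 1
  im_I : 0 < (B Complex.I).im

namespace FixesRealAxis

variable {B : ℂ →L[ℝ] ℂ}

theorem map_ofReal (hB : FixesRealAxis B) (x : ℝ) : B x = x := by
  have h : (x : ℂ) = x • (1 : ℂ) := by simp
  rw [h, map_smul, hB.map_one]

theorem det_pos (hB : FixesRealAxis B) : 0 < LinearMap.det (B : ℂ →ₗ[ℝ] ℂ) := by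
  rw [det_complex]
  simpa [hB.map_one] using hB.im_I

/-- Otherwise `B w = r w` with `r ≤ 0`. Comparing imaginary parts forces `w` to be real, and then `B
w = w` gives `w = 0`. -/
theorem div_mem_slitPlane (hB : FixesRealAxis B) {w : ℂ} (hw : w ≠ 0) :
    B w / w ∈ Complex.slitPlane := by
  by_contra h
  rw [Complex.mem_slitPlane_iff, not_or, not_lt, not_not] at h
  obtain ⟨hre, him⟩ := h
  set r := (B w / w).re with hr
  have h1 : B w = r * w := by
    have : B w / w = r := Complex.ext rfl (by simpa using him)
    rw [← this, div_mul_cancel₀ _ hw]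
  have h2 : B w = w.re + w.im * B Complex.I := by
    have h3 : w = ((w.re : ℝ) : ℂ) + w.im • Complex.I := by simp [Complex.re_add_im]
    conv_lhs => rw [h3]
    rw [map_add, map_smul, hB.map_ofReal, Complex.real_smul]
  rw [h2] at h1
  have him1 := congrArg Complex.im h1
  have hre1 := congrArg Complex.re h1
  simp at him1 hre1
  have hI := hB.im_I
  have hwim : w.im = 0 := by
    have h4 : w.im * ((B Complex.I).im - r) = 0 := by linarith
    rcases mul_eq_zero.1 h4 with h | h
    · exact h
    · linarith
  rw [hwim] at hre1
  have hwre : w.re = 0 := by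
    have h4 : w.re * (1 - r) = 0 := by linarith
    rcases mul_eq_zero.1 h4 with h | h
    · exact h
    · linarith
  exact hw (Complex.ext hwre hwim)

theorem ne_zero (hB : FixesRealAxis B) {w : ℂ} (hw : w ≠ 0) : B w ≠ 0 := fun h => by
  have := Complex.slitPlane_ne_zero (hB.div_mem_slitPlane hw)
  simp [h] at this

end FixesRealAxis

/-- The passage from `ψ` to `B(A^d)`, to `A^d`, to `w^d` changes the function each time by a
quotient, or a power of a quotient, with values in the slit plane. The principal logarithms add up
to `k`, and they are real on the real axis. -/
theorem exists_eq_pow_mul_exp {σ : ℝ} {ψ : ℂ → ℂ} {A B : ℂ →L[ℝ] ℂ} {d : ℕ}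
    (hA : FixesRealAxis A) (hB : FixesRealAxis B)
    (h : (fun w => ψ w - B (A w ^ d)) =o[𝓝[{w : ℂ | 0 ≤ σ * w.im}] 0] fun w => ‖w‖ ^ d) :
    ∃ ε > 0, ∀ S ⊆ {w : ℂ | 0 ≤ σ * w.im ∧ w ≠ 0 ∧ ‖w‖ ≤ ε}, ContinuousOn ψ S →
      (∀ x : ℝ, (x : ℂ) ∈ S → (ψ x).im = 0) →
      ∃ k : ℂ → ℂ, ContinuousOn k S ∧ (∀ x : ℝ, (x : ℂ) ∈ S → (k x).im = 0) ∧
        ∀ w ∈ S, ψ w = w ^ d * Complex.exp (k w) := by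
  obtain ⟨K, hK, hKA⟩ := exists_norm_le_mul_of_det_ne_zero hA.det_pos.ne'
  obtain ⟨K', hK', hKB⟩ := exists_norm_le_mul_of_det_ne_zero hB.det_pos.ne'
  have hlow : ∀ w, ‖w‖ ^ d ≤ K ^ d * K' * ‖B (A w ^ d)‖ := fun w => by
    calc ‖w‖ ^ d ≤ (K * ‖A w‖) ^ d := by gcongr; exact hKA w
      _ = K ^ d * ‖A w ^ d‖ := by rw [mul_pow, norm_pow]
      _ ≤ K ^ d * (K' * ‖B (A w ^ d)‖) := by gcongr; exact hKB _
      _ = _ := by ring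
  have hpos : 0 < (K ^ d * K')⁻¹ / 2 := by positivity
  obtain ⟨ε, hε, hb⟩ := (Metric.nhds_basis_closedBall.eventually_iff).1
    (eventually_nhdsWithin_iff.1 (h.def hpos))
  refine ⟨ε, hε, fun S hS hψ hreal => ?_⟩
  have hV : ∀ w ∈ S, A w ^ d ≠ 0 := fun w hw => pow_ne_zero _ (hA.ne_zero (hS hw).2.1)
  have hBV : ∀ w ∈ S, B (A w ^ d) ≠ 0 := fun w hw => hB.ne_zero (hV w hw)
  have hslit : ∀ w ∈ S, ψ w / B (A w ^ d) ∈ Complex.slitPlane := fun w hw => by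
    have h1 : ψ w / B (A w ^ d) = 1 + (ψ w - B (A w ^ d)) / B (A w ^ d) := by
      rw [sub_div, div_self (hBV w hw)]; ring
    rw [h1]
    refine Complex.mem_slitPlane_of_norm_lt_one ?_
    rw [norm_div, div_lt_one (norm_pos_iff.2 (hBV w hw))]
    have h2 := hb (x := w) (by simpa using (hS hw).2.2) (hS hw).1
    have h3 : (K ^ d * K')⁻¹ * ‖w‖ ^ d ≤ ‖B (A w ^ d)‖ := by
      rw [inv_mul_le_iff₀ (by positivity)]
      exact hlow w
    rw [norm_pow, norm_norm] at h2
    have h4 := norm_pos_iff.2 (hBV w hw)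
    linarith
  have hBc : ContinuousOn (fun w => B (A w ^ d)) S := by fun_prop
  refine ⟨fun w => Complex.log (ψ w / B (A w ^ d)) + Complex.log (B (A w ^ d) / A w ^ d) +
    d * Complex.log (A w / w), ?_, fun x hx => ?_, fun w hw => ?_⟩
  · refine (((hψ.div hBc hBV).clog hslit).add ((hBc.div (by fun_prop) hV).clog
      fun w hw => hB.div_mem_slitPlane (hV w hw))).add (continuousOn_const.mul
      (ContinuousOn.clog (ContinuousOn.div (by fun_prop) continuousOn_id
        fun w hw => (hS hw).2.1) fun w hw => hA.div_mem_slitPlane (hS hw).2.1))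
  · have hx0 : (x : ℂ) ≠ 0 := (hS hx).2.1
    have h1 := hslit x hx
    beta_reduce
    rw [hA.map_ofReal, ← Complex.ofReal_pow, hB.map_ofReal] at h1 ⊢
    have hxd : ((x ^ d : ℝ) : ℂ) ≠ 0 := by
      rw [Complex.ofReal_pow]; exact pow_ne_zero _ hx0
    rw [div_self hxd, div_self hx0, Complex.log_one, mul_zero, add_zero, add_zero, Complex.log_im]
    have h2 : ψ x = ((ψ x).re : ℂ) := Complex.ext rfl (by simpa using hreal x hx)
    rw [h2, ← Complex.ofReal_div] at h1 ⊢
    rw [Complex.mem_slitPlane_iff, Complex.ofReal_im, Complex.ofReal_re] at h1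
    exact Complex.arg_ofReal_of_nonneg (h1.resolve_right (by simp)).le
  · rw [Complex.exp_add, Complex.exp_add, Complex.exp_nat_mul,
      Complex.exp_log (Complex.slitPlane_ne_zero (hslit w hw)),
      Complex.exp_log (Complex.slitPlane_ne_zero (hB.div_mem_slitPlane (hV w hw))),
      Complex.exp_log (Complex.slitPlane_ne_zero (hA.div_mem_slitPlane (hS hw).2.1)),
      div_mul_div_cancel₀ (hBV w hw), div_pow, div_mul_div_cancel₀ (hV w hw),
      mul_div_cancel₀ _ (pow_ne_zero _ (hS hw).2.1)]

theorem hasLocalIndex_reflect {σ : ℝ} (hσ : σ ≠ 0) {φ : ℂ → ℂ} {L A : ℂ →L[ℝ] ℂ} {c : ℂ} {d : ℕ}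
    (hφ : ∀ᶠ w in 𝓝[{w : ℂ | 0 ≤ σ * w.im}] 0, ContinuousWithinAt φ {w : ℂ | 0 ≤ σ * w.im} w)
    (h0 : φ 0 = 0) (hL : 0 < LinearMap.det (L : ℂ →ₗ[ℝ] ℂ)) (hA : KeepsHalfPlane A) (hc : c ≠ 0)
    (hlead : (fun w => φ w - L (c * A w ^ d)) =o[𝓝[{w : ℂ | 0 ≤ σ * w.im}] 0] fun w => ‖w‖ ^ d)
    (hreal : ∀ᶠ x : ℝ in 𝓝 0, (φ x).im = 0) : HasLocalIndex (reflect σ φ) d := by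
  set α := (A 1).re with hα
  have hα0 : 0 < α := hA.re_one
  have hA1 : A 1 = α := Complex.ext rfl (by simpa using hA.im_one)
  have hA' : FixesRealAxis (α⁻¹ • A) := by
    refine ⟨?_, ?_⟩
    · rw [smul_apply, hA1, Complex.real_smul, ← Complex.ofReal_mul, inv_mul_cancel₀ hα0.ne',
        Complex.ofReal_one]
    · simpa using mul_pos (inv_pos.2 hα0) hA.im_I
  set κ : ℂ := c * α ^ d with hκ
  have hκ0 : κ ≠ 0 := mul_ne_zero hc (pow_ne_zero _ (by exact_mod_cast hα0.ne'))
  have hAd : ∀ w, c * A w ^ d = κ * (α⁻¹ • A) w ^ d := fun w => by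
    have : (α : ℂ) ≠ 0 := by exact_mod_cast hα0.ne'
    simp only [smul_apply, Complex.real_smul, hκ, mul_pow, Complex.ofReal_inv, inv_pow]
    field_simp
  set c₁ := L κ with hc₁
  have hc₁0 : c₁ ≠ 0 := fun h => by
    obtain ⟨K, -, hK⟩ := exists_norm_le_mul_of_det_ne_zero hL.ne'
    have := hK κ
    rw [← hc₁, h, norm_zero, mul_zero] at this
    exact hκ0 (norm_le_zero_iff.1 this)
  have hT : Tendsto (fun x : ℝ => (x : ℂ)) (𝓝[>] 0) (𝓝[{w : ℂ | 0 ≤ σ * w.im}] 0) :=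
    tendsto_nhdsWithin_iff.2 ⟨tendsto_ofReal_nhdsGT, Eventually.of_forall fun x => by simp⟩
  -- Along the positive axis `φ` is real with leading term `c₁ (x / α⁻¹) ^ d` up to the
  -- normalisation of `A`; since that normalised map fixes the axis, the term is `c₁ x ^ d` and `c₁`
  -- must be real.
  have hc₁r : c₁.im = 0 := by
    have h1 := isLittleO_norm_ofReal (hlead.comp_tendsto hT)
    have h2 : (fun x : ℝ => (c₁.im : ℂ) * (x : ℂ) ^ d) =o[𝓝[>] 0] fun x : ℝ => x ^ d := by
      refine IsBigO.trans_isLittleO (IsBigO.of_bound 1 ?_) h1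
      filter_upwards [hreal.filter_mono nhdsWithin_le_nhds] with x hx
      have h3 : L (c * A x ^ d) = (x ^ d : ℝ) * c₁ := by
        rw [hAd, hA'.map_ofReal, ← Complex.ofReal_pow, mul_comm, ← Complex.real_smul, map_smul,
          Complex.real_smul]
      have h4 := Complex.abs_im_le_norm (φ x - L (c * A x ^ d))
      rw [h3, Complex.sub_im, hx, zero_sub, abs_neg, Complex.im_ofReal_mul] at h4
      simp only [Function.comp_apply, one_mul]
      rw [h3, norm_mul, norm_pow, Complex.norm_real, Complex.norm_real, Real.norm_eq_abs,
        Real.norm_eq_abs, ← abs_pow, ← abs_mul, mul_comm]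
      exact h4
    exact_mod_cast eq_zero_of_isLittleO h2
  have hc₁' : c₁ = (c₁.re : ℂ) := Complex.ext rfl (by simpa using hc₁r)
  -- `L` is normalised to send `1` to `1`; positivity of its determinant then says exactly that the
  -- upper half-plane is preserved.
  set B : ℂ →L[ℝ] ℂ := ((ContinuousLinearMap.mul ℂ ℂ c₁⁻¹).restrictScalars ℝ).comp
    (L.comp ((ContinuousLinearMap.mul ℂ ℂ κ).restrictScalars ℝ)) with hBdef
  have hBap : ∀ v, B v = c₁⁻¹ * L (κ * v) := fun v => rfl
  have hB1 : B 1 = 1 := by rw [hBap, mul_one, ← hc₁, inv_mul_cancel₀ hc₁0]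
  have hdetmul : ∀ b : ℂ, b ≠ 0 →
      0 < LinearMap.det (((ContinuousLinearMap.mul ℂ ℂ b).restrictScalars ℝ : ℂ →L[ℝ] ℂ) : ℂ →ₗ[ℝ] ℂ) :=
    fun b hb => by
      rw [det_complex]
      have := Complex.normSq_pos.2 hb
      rw [Complex.normSq_apply] at this
      simpa using this
  have hB : FixesRealAxis B := by
    refine ⟨hB1, ?_⟩
    have h1 : 0 < LinearMap.det (B : ℂ →ₗ[ℝ] ℂ) := by
      have h2 : (B : ℂ →ₗ[ℝ] ℂ) =
          (((ContinuousLinearMap.mul ℂ ℂ c₁⁻¹).restrictScalars ℝ : ℂ →L[ℝ] ℂ) : ℂ →ₗ[ℝ] ℂ) ∘ₗ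
          (L : ℂ →ₗ[ℝ] ℂ) ∘ₗ
          (((ContinuousLinearMap.mul ℂ ℂ κ).restrictScalars ℝ : ℂ →L[ℝ] ℂ) : ℂ →ₗ[ℝ] ℂ) := rfl
      rw [h2, LinearMap.det_comp, LinearMap.det_comp]
      exact mul_pos (hdetmul _ (inv_ne_zero hc₁0)) (mul_pos hL (hdetmul _ hκ0))
    rw [det_complex] at h1
    simpa [hB1] using h1
  have hlead' : (fun w => c₁⁻¹ * φ w - B ((α⁻¹ • A) w ^ d)) =o[𝓝[{w : ℂ | 0 ≤ σ * w.im}] 0]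
      fun w => ‖w‖ ^ d := by
    refine (hlead.const_mul_left c₁⁻¹).congr_left fun w => ?_
    rw [hBap, ← hAd]
    ring
  obtain ⟨ε, hε, hexp⟩ := exists_eq_pow_mul_exp hA' hB hlead'
  obtain ⟨ε₁, hε₁, hcont⟩ := (Metric.nhds_basis_closedBall.eventually_iff).1
    (eventually_nhdsWithin_iff.1 hφ)
  obtain ⟨ε₂, hε₂, hre⟩ := (Metric.nhds_basis_closedBall.eventually_iff).1 hreal
  set R := min ε (min ε₁ ε₂) with hR
  have hR0 : 0 < R := lt_min hε (lt_min hε₁ hε₂)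
  have hR1 : R ≤ ε := min_le_left _ _
  have hR2 : R ≤ ε₁ := (min_le_right _ _).trans (min_le_left _ _)
  have hR3 : R ≤ ε₂ := (min_le_right _ _).trans (min_le_right _ _)
  have hφR : ContinuousOn φ (Metric.closedBall 0 R ∩ {w | 0 ≤ σ * w.im}) := fun w hw =>
    (hcont (x := w) (Metric.closedBall_subset_closedBall hR2 hw.1) hw.2).mono Set.inter_subset_right
  have hreR : ∀ x : ℝ, (x : ℂ) ∈ Metric.closedBall (0 : ℂ) R → (φ x).im = 0 := fun x hx => by
    refine hre (x := x) ?_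
    rw [mem_closedBall_zero_iff] at hx ⊢
    rw [Complex.norm_real] at hx
    exact hx.trans hR3
  have hconjB : ∀ w ∈ Metric.closedBall (0 : ℂ) R, conj w ∈ Metric.closedBall (0 : ℂ) R :=
    fun w hw => by simpa using hw
  have hsphere : ∀ r, 0 < r → r ≤ R → LogEquivOn (Metric.sphere 0 r) (reflect σ φ)
      fun w => c₁ * w ^ d := fun r hr hrR => by
    have hSR : Metric.sphere (0 : ℂ) r ⊆ Metric.closedBall 0 R :=
      Metric.sphere_subset_closedBall.trans (Metric.closedBall_subset_closedBall hrR)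
    have hreal' : ∀ x : ℝ, (x : ℂ) ∈ Metric.sphere (0 : ℂ) r ∩ {w | 0 ≤ σ * w.im} →
        (c₁⁻¹ * φ x).im = 0 := fun x hx => by
      rw [hc₁', ← Complex.ofReal_inv, Complex.im_ofReal_mul, hreR x (hSR hx.1), mul_zero]
    obtain ⟨k, hk, hkr, hkφ⟩ := hexp (Metric.sphere 0 r ∩ {w | 0 ≤ σ * w.im}) (fun w hw => by
      have hwr : ‖w‖ = r := mem_sphere_zero_iff_norm.1 hw.1
      refine ⟨hw.2, fun h => ?_, hwr.le.trans (hrR.trans hR1)⟩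
      rw [h, norm_zero] at hwr
      exact hr.ne hwr)
      (continuousOn_const.mul (hφR.mono (Set.inter_subset_inter_left _ hSR))) hreal'
    have hedge : ∀ x : ℝ, (x : ℂ) ∈ Metric.sphere (0 : ℂ) r →
        (x : ℂ) ∈ Metric.sphere (0 : ℂ) r ∩ {w | 0 ≤ σ * w.im} := fun x hx => ⟨hx, by simp⟩
    have hconjS : ∀ w ∈ Metric.sphere (0 : ℂ) r, conj w ∈ Metric.sphere (0 : ℂ) r :=
      fun w hw => by simpa using hw
    have hkφ' : ∀ w ∈ Metric.sphere (0 : ℂ) r ∩ {w | 0 ≤ σ * w.im},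
        φ w = c₁ * w ^ d * Complex.exp (k w) := fun w hw => by
      rw [mul_assoc, ← hkφ w hw, mul_inv_cancel_left₀ hc₁0]
    -- As `c₁` is real, conjugation respects `c₁ w ^ d exp k`, so the reflected `k` is a logarithm
    -- on the full circle.
    refine ⟨reflect σ k, continuousOn_reflect hσ Metric.isClosed_sphere hconjS hk
      fun x hx => hkr x (hedge x hx), fun w hw => ?_⟩
    rcases le_total 0 (σ * w.im) with h | h
    · rw [reflect_of_nonneg h, reflect_of_nonneg h, hkφ' w ⟨hw, h⟩]
    · rw [reflect_of_nonpos hσ h fun x hx => hreR x (hSR (hx ▸ hw)),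
        reflect_of_nonpos hσ h fun x hx => hkr x (hedge x (hx ▸ hw)),
        hkφ' _ ⟨hconjS w hw, by simpa using h⟩, map_mul, map_mul, map_pow, Complex.conj_conj,
        ← Complex.exp_conj, Complex.conj_eq_iff_im.2 hc₁r]
  refine hasLocalIndex_of_logEquivOn hR0
    (continuousOn_reflect hσ Metric.isClosed_closedBall hconjB hφR hreR) (fun w hw => ?_)
    fun r hr hrR => ((hsphere r hr hrR).trans (LogEquivOn.const_mul hc₁0 _)).trans
      (LogEquivOn.of_eqOn fun w _ => (zpow_natCast w d).symm)
  refine ⟨fun h => ?_, fun h => ?_⟩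
  · by_contra hw0
    obtain ⟨k, -, hk⟩ := hsphere ‖w‖ (norm_pos_iff.2 hw0) (mem_closedBall_zero_iff.1 hw)
    have h1 := hk w (by simp)
    rw [h] at h1
    exact mul_ne_zero (mul_ne_zero hc₁0 (pow_ne_zero _ hw0)) (Complex.exp_ne_zero _) h1.symm
  · rw [h, reflect_of_nonneg (by simp), h0]

/-! ### Hadamard's lemma and making the edges real -/

theorem hasDerivAt_integral_pow_mul_comp {g : ℝ → ℂ} (hg : ContDiff ℝ ∞ g) (j : ℕ) (x : ℝ) :
    HasDerivAt (fun x => ∫ t in (0 : ℝ)..1, (t : ℂ) ^ j * g (t * x))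
      (∫ t in (0 : ℝ)..1, (t : ℂ) ^ (j + 1) * deriv g (t * x)) x := by
  have hg' : Continuous (deriv g) := hg.continuous_deriv (by simp)
  obtain ⟨B, hB⟩ := (isCompact_Icc (a := -(|x| + 1)) (b := |x| + 1)).exists_bound_of_continuousOn
    hg'.continuousOn
  have hc : ∀ y : ℝ, Continuous fun t : ℝ => (t : ℂ) ^ j * g (t * y) := fun y =>
    (Complex.continuous_ofReal.pow j).mul (hg.continuous.comp (continuous_id.mul continuous_const))
  have hc' : Continuous fun t : ℝ => (t : ℂ) ^ (j + 1) * deriv g (t * x) :=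
    (Complex.continuous_ofReal.pow (j + 1)).mul (hg'.comp (continuous_id.mul continuous_const))
  refine (intervalIntegral.hasDerivAt_integral_of_dominated_loc_of_deriv_le
    (F := fun x t => (t : ℂ) ^ j * g (t * x))
    (F' := fun x t => (t : ℂ) ^ (j + 1) * deriv g (t * x))
    (s := Metric.ball x 1) (bound := fun _ => B) (Metric.ball_mem_nhds x one_pos)
    (Eventually.of_forall fun y => (hc y).aestronglyMeasurable)
    ((hc x).intervalIntegrable 0 1) hc'.aestronglyMeasurable ?_ (by simp) ?_).2
  · refine Eventually.of_forall fun t ht y hy => ?_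
    rw [Set.uIoc_of_le zero_le_one] at ht
    have hy' : |y| ≤ |x| + 1 := by
      rw [Metric.mem_ball, Real.dist_eq] at hy
      have := abs_add_le (y - x) x
      rw [sub_add_cancel] at this
      linarith
    have hty : t * y ∈ Set.Icc (-(|x| + 1)) (|x| + 1) := by
      rw [Set.mem_Icc, ← abs_le, abs_mul, abs_of_pos ht.1]
      nlinarith [abs_nonneg y, ht.2, ht.1]
    have h1 : ‖(t : ℂ) ^ (j + 1)‖ ≤ 1 := by
      rw [norm_pow, Complex.norm_real, Real.norm_eq_abs, abs_of_pos ht.1]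
      exact pow_le_one₀ ht.1.le ht.2
    rw [norm_mul]
    calc _ ≤ 1 * B := mul_le_mul h1 (hB _ hty) (norm_nonneg _) zero_le_one
      _ = B := one_mul B
  · refine Eventually.of_forall fun t _ y _ => ?_
    have h1 : HasDerivAt (fun y : ℝ => t * y) t y := by simpa using (hasDerivAt_id y).const_mul t
    have h2 : HasDerivAt g (deriv g (t * y)) (t * y) :=
      (hg.differentiable (by simp) (t * y)).hasDerivAt
    have h3 := (h2.scomp y h1).const_mul ((t : ℂ) ^ j)
    refine h3.congr_deriv ?_
    rw [Complex.real_smul, pow_succ, mul_assoc]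

/-- The weight `t ^ j` makes the family closed under differentiation: `j` becomes `j + 1` and `g`
becomes its derivative. -/
theorem contDiff_integral_pow_mul_comp {g : ℝ → ℂ} (hg : ContDiff ℝ ∞ g) (j : ℕ) :
    ContDiff ℝ ∞ fun x => ∫ t in (0 : ℝ)..1, (t : ℂ) ^ j * g (t * x) := by
  refine contDiff_infty.2 fun k => ?_
  induction k generalizing g j with
  | zero =>
    refine contDiff_zero.2 (intervalIntegral.continuous_parametric_intervalIntegral_of_continuous'
      (f := fun x t => (t : ℂ) ^ j * g (t * x)) ?_ 0 1)
    have := hg.continuous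
    simp only [Function.uncurry_def]
    fun_prop
  | succ k ih =>
    have hd := hasDerivAt_integral_pow_mul_comp hg j
    push_cast
    refine contDiff_succ_iff_deriv.2 ⟨fun x => (hd x).differentiableAt, by simp, ?_⟩
    have h1 : deriv (fun x => ∫ t in (0 : ℝ)..1, (t : ℂ) ^ j * g (t * x)) =
        fun x => ∫ t in (0 : ℝ)..1, (t : ℂ) ^ (j + 1) * deriv g (t * x) :=
      funext fun x => (hd x).deriv
    rw [h1]
    exact ih (contDiff_infty_iff_deriv.1 hg).2 (j + 1)

/-- Hadamard's lemma for globally smooth functions of a real variable. -/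
theorem exists_contDiff_eq_mul {f : ℝ → ℂ} (hf : ContDiff ℝ ∞ f) (h0 : f 0 = 0) :
    ∃ q : ℝ → ℂ, ContDiff ℝ ∞ q ∧ ∀ x, f x = x * q x := by
  have hf' : ContDiff ℝ ∞ (deriv f) := (contDiff_infty_iff_deriv.1 hf).2
  refine ⟨_, contDiff_integral_pow_mul_comp hf' 0, fun x => ?_⟩
  have h1 := intervalIntegral.integral_eq_sub_of_hasDerivAt (a := 0) (b := 1)
    (f := fun t : ℝ => f (t * x)) (f' := fun t : ℝ => x * deriv f (t * x)) (fun t _ => ?_) ?_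
  · simp only [one_mul, zero_mul, h0, sub_zero, intervalIntegral.integral_const_mul] at h1
    simp [← h1]
  · have h2 : HasDerivAt (fun t : ℝ => t * x) x t := by simpa using (hasDerivAt_id t).mul_const x
    have h3 : HasDerivAt f (deriv f (t * x)) (t * x) :=
      (hf.differentiable (by simp) (t * x)).hasDerivAt
    exact (h3.scomp t h2).congr_deriv (Complex.real_smul)
  · refine Continuous.intervalIntegrable ?_ 0 1
    have := hf'.continuous
    fun_prop

theorem SmoothNear.exists_contDiff_eventuallyEq {f : ℝ → ℂ} (hf : SmoothNear f 0) :
    ∃ g : ℝ → ℂ, ContDiff ℝ ∞ g ∧ g =ᶠ[𝓝 0] f := by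
  have hf' : ∀ᶠ x in 𝓝 (0 : ℝ), ContDiffAt ℝ ∞ f x := hf
  obtain ⟨ε, hε, hb⟩ := Metric.nhds_basis_ball.eventually_iff.1 hf'
  let b : ContDiffBump (0 : ℝ) := ⟨ε / 4, ε / 2, by positivity, by linarith⟩
  refine ⟨fun x => (b x : ℂ) * f x, contDiff_iff_contDiffAt.2 fun x => ?_, ?_⟩
  · by_cases hx : x ∈ Metric.ball (0 : ℝ) ε
    · exact (Complex.ofRealCLM.contDiff.contDiffAt.comp x b.contDiffAt).mul (hb hx)
    · have hx' : x ∈ (tsupport b)ᶜ := fun h => hx (by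
        rw [b.tsupport_eq] at h
        exact Metric.closedBall_subset_ball (half_lt_self hε) h)
      refine (contDiffAt_const (c := (0 : ℂ))).congr_of_eventuallyEq ?_
      filter_upwards [(isClosed_tsupport b).isOpen_compl.mem_nhds hx'] with y hy
      rw [image_eq_zero_of_notMem_tsupport hy, Complex.ofReal_zero, zero_mul]
  · filter_upwards [b.eventuallyEq_one] with x hx
    simp [hx]

theorem SmoothNear.exists_eq_mul {f : ℝ → ℂ} (hf : SmoothNear f 0) (h0 : f 0 = 0) :
    ∃ q : ℝ → ℂ, SmoothNear q 0 ∧ ∀ᶠ x in 𝓝 (0 : ℝ), f x = x * q x := by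
  obtain ⟨g, hg, hgf⟩ := hf.exists_contDiff_eventuallyEq
  obtain ⟨q, hq, hgq⟩ := exists_contDiff_eq_mul hg (hgf.self_of_nhds.trans h0)
  exact ⟨q, Eventually.of_forall fun x => hq.contDiffAt, hgf.mono fun x hx => hx ▸ hgq x⟩

/-- Hadamard's lemma is iterated. The bound is on a punctured neighbourhood because division by `x`
carries no information at `0`. -/
theorem SmoothNear.exists_eq_pow_mul (d : ℕ) {f : ℝ → ℂ} (hf : SmoothNear f 0)
    (h : f =O[𝓝[≠] 0] fun x : ℝ => x ^ d) :
    ∃ q : ℝ → ℂ, SmoothNear q 0 ∧ ∀ᶠ x in 𝓝 (0 : ℝ), f x = x ^ d * q x := by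
  induction d generalizing f with
  | zero => exact ⟨f, hf, Eventually.of_forall fun x => by simp⟩
  | succ d ih =>
    have h0 : f 0 = 0 := by
      have h1 : Tendsto f (𝓝[≠] 0) (𝓝 0) := by
        refine h.trans_tendsto (Tendsto.mono_left ?_ nhdsWithin_le_nhds)
        have : Tendsto (fun x : ℝ => x ^ (d + 1)) (𝓝 0) (𝓝 (0 ^ (d + 1))) :=
          (continuous_pow (d + 1)).tendsto 0
        simpa using this
      exact tendsto_nhds_unique
        (hf.contDiffAt.continuousAt.tendsto.mono_left nhdsWithin_le_nhds) h1
    obtain ⟨q, hq, hfq⟩ := hf.exists_eq_mul h0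
    have hqO : q =O[𝓝[≠] 0] fun x : ℝ => x ^ d := by
      obtain ⟨B, hB⟩ := h.bound
      refine IsBigO.of_bound B ?_
      filter_upwards [hB, hfq.filter_mono nhdsWithin_le_nhds, self_mem_nhdsWithin] with x h1 h2 hx
      rw [h2, pow_succ, norm_mul, norm_mul, Complex.norm_real, mul_comm, ← mul_assoc] at h1
      exact le_of_mul_le_mul_right h1 (norm_pos_iff.2 hx)
    obtain ⟨k, hk, hqk⟩ := ih hq hqO
    refine ⟨k, hk, ?_⟩
    filter_upwards [hfq, hqk] with x h1 h2
    rw [h1, h2, pow_succ]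
    ring

/-- Write `f = x ^ d q`; `q 0 = 0` would make `r` zero, so `κ = 1 / q` is smooth. It is the factor
that makes the edge real. -/
theorem SmoothNear.exists_mul_eq_pow {f : ℝ → ℂ} (hf : SmoothNear f 0) {r : ℂ} (hr : r ≠ 0) {d : ℕ}
    (h : (fun x : ℝ => f x - r * (x : ℂ) ^ d) =O[𝓝 0] fun x : ℝ => x ^ (d + 1)) :
    ∃ κ : ℝ → ℂ, SmoothNear κ 0 ∧ κ 0 ≠ 0 ∧ ∀ᶠ x in 𝓝 (0 : ℝ), f x * κ x = x ^ d := by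
  have hpow : (fun x : ℝ => x ^ (d + 1)) =o[𝓝 0] fun x : ℝ => x ^ d := by
    have h1 : (fun x : ℝ => x) =o[𝓝 0] fun _ => (1 : ℝ) := (isLittleO_one_iff ℝ).2 tendsto_id
    simpa [pow_succ] using (isBigO_refl (fun x : ℝ => x ^ d) (𝓝 0)).mul_isLittleO h1
  have hlead : (fun x : ℝ => r * (x : ℂ) ^ d) =O[𝓝 0] fun x : ℝ => x ^ d :=
    IsBigO.of_bound ‖r‖ (Eventually.of_forall fun x => by simp)
  obtain ⟨q, hq, hfq⟩ := hf.exists_eq_pow_mul d (IsBigO.mono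
    (((h.trans hpow.isBigO).add hlead).congr_left fun x => by ring) nhdsWithin_le_nhds)
  have hq0 : q 0 ≠ 0 := fun h0 => hr <| by
    have h1 : q =o[𝓝 0] fun _ : ℝ => (1 : ℝ) := by
      rw [isLittleO_one_iff, ← h0]
      exact hq.contDiffAt.continuousAt.tendsto
    have h2 : f =o[𝓝 0] fun x : ℝ => x ^ d := by
      have h3 : (fun x : ℝ => (x : ℂ) ^ d) =O[𝓝 0] fun x : ℝ => x ^ d :=
        IsBigO.of_bound 1 (Eventually.of_forall fun x => by simp)
      refine (h3.mul_isLittleO h1).congr' (hfq.mono fun x hx => hx.symm)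
        (Eventually.of_forall fun x => mul_one _)
    refine eq_zero_of_isLittleO (m := d) (IsLittleO.mono ?_ nhdsWithin_le_nhds)
    exact (h2.sub (h.trans_isLittleO hpow)).congr_left fun x => by ring
  have hqne : ∀ᶠ x in 𝓝 (0 : ℝ), q x ≠ 0 := hq.contDiffAt.continuousAt.eventually_ne hq0
  refine ⟨fun x => (q x)⁻¹, ?_, inv_ne_zero hq0, ?_⟩
  · have hq' : ∀ᶠ x in 𝓝 (0 : ℝ), ContDiffAt ℝ ∞ q x := hq
    exact (hq'.and hqne).mono fun x hx => hx.1.inv hx.2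
  · filter_upwards [hfq, hqne] with x h1 h2
    rw [h1, mul_inv_cancel_right₀ h2]

theorem tendsto_sign_mul_ofReal (σ : ℝ) :
    Tendsto (fun x : ℝ => (σ : ℂ) * x) (𝓝 0) (𝓝[{z : ℂ | 0 ≤ z.im}] 0) := by
  refine tendsto_nhdsWithin_iff.2 ⟨?_, Eventually.of_forall fun x => by simp⟩
  have : Continuous fun x : ℝ => (σ : ℂ) * x := by fun_prop
  simpa using this.tendsto 0

theorem IsGraphForm.zero {u₁ u₂ : ℂ → ℂ × ℂ} {σ : ℝ} {φ : ℂ → ℂ} (h0 : u₁ 0 = u₂ 0)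
    (h : IsGraphForm u₁ u₂ σ φ) : φ 0 = 0 := by
  obtain ⟨-, v₁, v₂, η₁, η₂, Ψ, hv₁, hv₂, hη₁, hη₂, hΨ, hΨ0, hdet, hgr⟩ := h
  have h1 := (hgr.self_of_nhdsWithin (by simp)).2
  rw [hη₂.zero, hv₂.eq_zero, ← h0, hΨ0, mul_zero] at h1
  exact (congrArg Prod.snd h1).symm

/-- A graph form with finite order of tangency can be changed so that both edges become real. -/
theorem IsGraphForm.exists_real {u₁ u₂ : ℂ → ℂ × ℂ} (h0 : u₁ 0 = u₂ 0) {σ : ℝ} {φ : ℂ → ℂ}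
    (h : IsGraphForm u₁ u₂ σ φ) {r : ℂ} (hr : r ≠ 0) {d : ℕ}
    (hd : (fun x : ℝ => φ x - r * (x : ℂ) ^ d) =O[𝓝 0] fun x : ℝ => x ^ (d + 1)) :
    ∃ φ' : ℂ → ℂ, IsGraphForm u₁ u₂ σ φ' ∧ ∀ᶠ x : ℝ in 𝓝 0, (φ' x).im = 0 := by
  obtain ⟨hσ, v₁, v₂, η₁, η₂, Ψ, hv₁, hv₂, hη₁, hη₂, hΨ, hΨ0, hdet, hgr⟩ := h
  have hp : v₂ (η₂ (σ * (0 : ℝ))) = u₁ 0 := by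
    rw [Complex.ofReal_zero, mul_zero, hη₂.zero, hv₂.eq_zero, h0]
  have hf : SmoothNear (fun x : ℝ => (Ψ (v₂ (η₂ (σ * x)))).2) 0 := by
    have h1 : SmoothNear (fun x : ℝ => (σ : ℂ) * x) 0 := Eventually.of_forall fun x =>
      contDiffAt_const.mul Complex.ofRealCLM.contDiff.contDiffAt
    have h2 : SmoothNear (fun x : ℝ => η₂ (σ * x)) 0 :=
      SmoothNear.comp (by simpa using hη₂.smooth) h1
    have h3 : SmoothNear (fun x : ℝ => v₂ (η₂ (σ * x))) 0 :=
      SmoothNear.comp (by simpa [hη₂.zero] using hv₂.1) h2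
    have h4 : SmoothNear (fun x : ℝ => Ψ (v₂ (η₂ (σ * x)))) 0 :=
      SmoothNear.comp (by rwa [hp]) h3
    exact Eventually.mono h4 fun x hx => hx.snd
  have hfφ : ∀ᶠ x : ℝ in 𝓝 0, (Ψ (v₂ (η₂ (σ * x)))).2 = φ x := by
    filter_upwards [(tendsto_sign_mul_ofReal σ).eventually hgr] with x hx
    rw [hx.2, ← mul_assoc, sign_mul_self hσ, one_mul]
  obtain ⟨κ, hκ, hκ0, hκf⟩ := hf.exists_mul_eq_pow hr
    (hd.congr' (hfφ.mono fun x hx => by beta_reduce; rw [hx]) EventuallyEq.rfl)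
  -- This change fixes `ℂ × 0`, and its differential at `0` multiplies the normal by the complex
  -- number `κ 0 ≠ 0`, so orientation is kept. On the real axis it turns `φ` into `x ^ d`.
  set Θ : ℂ × ℂ → ℂ × ℂ := fun q => (q.1, q.2 * κ q.1.re) with hΘ
  have hre : ∀ q : ℂ × ℂ, ContDiffAt ℝ ∞ (fun q : ℂ × ℂ => q.1.re) q := fun q =>
    (Complex.reCLM.contDiff.comp contDiff_fst).contDiffAt
  have hκre : SmoothNear (fun q : ℂ × ℂ => κ q.1.re) 0 :=
    SmoothNear.comp (f := fun q : ℂ × ℂ => q.1.re) (by simpa using hκ) (Eventually.of_forall hre)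
  have hΘs : SmoothNear Θ 0 := Eventually.mono hκre fun q hq =>
    contDiffAt_fst.prodMk (contDiffAt_snd.mul hq)
  have hΘd : HasFDerivAt Θ ((ContinuousLinearMap.fst ℝ ℂ ℂ).prod
      (κ 0 • ContinuousLinearMap.snd ℝ ℂ ℂ)) 0 := by
    have h1 := hasFDerivAt_snd.mul (𝕜 := ℝ) hκre.differentiableAt.hasFDerivAt
    refine (hasFDerivAt_fst.prodMk h1).congr_fderiv ?_
    ext q <;> simp
  have hΘdet : 0 < LinearMap.det (((ContinuousLinearMap.fst ℝ ℂ ℂ).prod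
      (κ 0 • ContinuousLinearMap.snd ℝ ℂ ℂ) : ℂ × ℂ →L[ℝ] ℂ × ℂ) : ℂ × ℂ →ₗ[ℝ] ℂ × ℂ) := by
    rw [det_of_triangular _ LinearMap.id (κ 0 • LinearMap.id) (by simp) (by simp), LinearMap.det_id,
      one_mul, det_complex]
    have := Complex.normSq_pos.2 hκ0
    rw [Complex.normSq_apply] at this
    simpa using this
  refine ⟨fun w => φ w * κ w.re, ⟨hσ, v₁, v₂, η₁, η₂, fun q => Θ (Ψ q), hv₁, hv₂, hη₁, hη₂,
    SmoothNear.comp (by rwa [hΨ0]) hΨ, by simp [hΘ, hΨ0], ?_, ?_⟩, ?_⟩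
  · have h1 : HasFDerivAt (fun q => Θ (Ψ q)) (((ContinuousLinearMap.fst ℝ ℂ ℂ).prod
      (κ 0 • ContinuousLinearMap.snd ℝ ℂ ℂ)).comp (fderiv ℝ Ψ (u₁ 0))) (u₁ 0) :=
      HasFDerivAt.comp (g := Θ) (u₁ 0) (by rwa [hΨ0]) hΨ.differentiableAt.hasFDerivAt
    rw [h1.fderiv]
    have h2 := mul_pos hΘdet hdet
    rw [ContinuousLinearMap.det, ← LinearMap.det_comp] at h2
    exact h2
  · filter_upwards [hgr] with z hz
    rw [hz.1, hz.2]
    simp [hΘ]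
  · filter_upwards [hfφ, hκf] with x hx hx'
    rw [← hx, Complex.ofReal_re, hx', ← Complex.ofReal_pow, Complex.ofReal_im]

/-! ### Order of tangency, index and transversality -/

section

variable {u u₁ u₂ v v' w : ℂ → ℂ × ℂ} {N : ℕ} {Φ : ℂ × ℂ → ℂ} {μ ℓ : ℂ × ℂ →L[ℂ] ℂ}
  {σ : ℝ} {φ : ℂ → ℂ}

theorem sub_isBigO_of_isSmoothExtensionAt (hv : IsSmoothExtensionAt u v 0)
    (hv' : IsSmoothExtensionAt u v' 0) (hΦ : HasStrictFDerivAt Φ μ (v 0)) (k : ℕ) :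
    (fun z => Φ (v' z) - Φ (v z)) =O[𝓝 0] fun z => ‖z‖ ^ k := by
  have h1 : Tendsto v (𝓝 0) (𝓝 (v 0)) := hv.1.contDiffAt.continuousAt.tendsto
  have h2 : Tendsto v' (𝓝 0) (𝓝 (v 0)) := by
    have := hv'.1.contDiffAt.continuousAt.tendsto
    rwa [hv'.eq_zero, ← hv.eq_zero] at this
  exact (hΦ.isBigO_sub.comp_tendsto (h2.prodMk_nhds h1)).trans (hv.sub_isBigO hv' k)

theorem IsDefiningFunction.congr (hΦ : IsDefiningFunction v N Φ μ ℓ)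
    (hv : IsSmoothExtensionAt u v 0) (hv' : IsSmoothExtensionAt u v' 0) :
    IsDefiningFunction v' N Φ μ ℓ where
  strict := by rw [hv'.eq_zero, ← hv.eq_zero]; exact hΦ.strict
  vanish := ((sub_isBigO_of_isSmoothExtensionAt hv hv' hΦ.strict N).add hΦ.vanish).congr_left
    fun z => by ring
  holJet := hΦ.holJet
  normal := by rw [← hv'.fderivWithin_eq, hv.fderivWithin_eq]; exact hΦ.normal
  tangent := by rw [← hv'.fderivWithin_eq, hv.fderivWithin_eq]; exact hΦ.tangent
  injective := hΦ.injective

/-- `Φ` and `w` are fixed in advance: the extensions used in the graph form differ from `v` and `w`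
by flat terms, so one expansion of `Φ ∘ w` serves all graph forms. -/
theorem IsGraphForm.sub_isLittleO (hu₁ : IsAnalyticHalfDisk u₁) (h0 : u₁ 0 = u₂ 0)
    (hv : IsSmoothExtensionAt u₁ v 0) (hw : IsSmoothExtensionAt u₂ w 0)
    (hΦ : IsDefiningFunction v N Φ μ ℓ) (h : IsGraphForm u₁ u₂ σ φ) :
    ∃ L A : ℂ →L[ℝ] ℂ, 0 < LinearMap.det (L : ℂ →ₗ[ℝ] ℂ) ∧ KeepsHalfPlane A ∧
      ∀ (m : ℕ) (c : ℂ), m < N →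
        (fun z => Φ (w z) - c * z ^ m) =O[𝓝 0] (fun z => ‖z‖ ^ (m + 1)) →
        (fun w => φ w - L (c * σ ^ m * A w ^ m)) =o[𝓝[{w : ℂ | 0 ≤ σ * w.im}] 0]
          fun w => ‖w‖ ^ m := by
  obtain ⟨hσ, v₁, v₂, η₁, η₂, Ψ, hv₁, hv₂, hη₁, hη₂, hΨ, hΨ0, hdet, hgr⟩ := h
  have h1 := hv₁.eq_zero
  have h12 : v₂ 0 = v₁ 0 := by rw [h1, hv₂.eq_zero, h0]
  obtain ⟨L, A, hL, hA, hlead⟩ := graph_sub_isLittleO hσ hv₁.1 hv₂.1 h12 (hv₁.fderiv_apply hu₁)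
    hη₁ hη₂ (by rwa [h1]) (by rwa [h1]) (by rwa [h1]) hgr (hΦ.congr hv hv₁)
  refine ⟨L, A, hL, hA, fun m c hm hc => hlead m c hm ?_⟩
  have hΦw : HasStrictFDerivAt Φ μ (w 0) := by
    rw [hw.eq_zero, ← h0, ← hv.eq_zero]
    exact hΦ.strict
  exact ((sub_isBigO_of_isSmoothExtensionAt hw hv₂ hΦw (m + 1)).add hc).congr_left
    fun z => by ring

theorem IsGraphForm.eventually_continuousWithinAt (h0 : u₁ 0 = u₂ 0) (h : IsGraphForm u₁ u₂ σ φ) :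
    ∀ᶠ w in 𝓝[{w : ℂ | 0 ≤ σ * w.im}] 0, ContinuousWithinAt φ {w : ℂ | 0 ≤ σ * w.im} w := by
  obtain ⟨hσ, v₁, v₂, η₁, η₂, Ψ, hv₁, hv₂, hη₁, hη₂, hΨ, hΨ0, hdet, hgr⟩ := h
  have h1 : SmoothNear (fun z => v₂ (η₂ z)) 0 :=
    SmoothNear.comp (by rw [hη₂.zero]; exact hv₂.1) hη₂.smooth
  have h2 : SmoothNear (fun z => Ψ (v₂ (η₂ z))) 0 :=
    SmoothNear.comp (by rwa [hη₂.zero, hv₂.eq_zero, ← h0]) h1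
  have h3 : ∀ᶠ w in 𝓝[{w : ℂ | 0 ≤ σ * w.im}] 0, φ w = (Ψ (v₂ (η₂ (σ * w)))).2 := by
    filter_upwards [(tendsto_mul_sign σ).eventually hgr] with w hw
    rw [hw.2, ← mul_assoc, sign_mul_self hσ, one_mul]
  have h4 : ∀ᶠ w in 𝓝[{w : ℂ | 0 ≤ σ * w.im}] 0, ContDiffAt ℝ ∞ (fun z => Ψ (v₂ (η₂ z))) (σ * w) :=
    ((tendsto_mul_sign σ).mono_right nhdsWithin_le_nhds).eventually h2
  filter_upwards [eventually_eventually_nhdsWithin.2 h3, h4, self_mem_nhdsWithin] with w hw hw' hmem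
  have h5 : ContinuousAt (fun w : ℂ => (Ψ (v₂ (η₂ (σ * w)))).2) w :=
    continuousAt_snd.comp (ContinuousAt.comp (g := fun z => Ψ (v₂ (η₂ z))) hw'.continuousAt
      (continuous_const.mul continuous_id).continuousAt)
  exact h5.continuousWithinAt.congr_of_eventuallyEq hw (hw.self_of_nhdsWithin hmem)

/-- The order of tangency is the order of vanishing on the second curve of a defining function
of the first one. -/
theorem exists_sub_isBigO_of_tangency {d : ℕ} (hu₁ : IsAnalyticHalfDisk u₁)
    (hu₂ : IsAnalyticHalfDisk u₂) (h0 : u₁ 0 = u₂ 0) (hv : IsSmoothExtensionAt u₁ v 0)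
    (hw : IsSmoothExtensionAt u₂ w 0) (hΦ : IsDefiningFunction v (d + 1) Φ μ ℓ)
    (h : IsGraphForm u₁ u₂ σ φ) {r : ℂ} (hr : r ≠ 0)
    (hd : (fun x : ℝ => φ x - r * (x : ℂ) ^ d) =O[𝓝 0] fun x : ℝ => x ^ (d + 1)) :
    ∃ c : ℂ, c ≠ 0 ∧ (fun z => Φ (w z) - c * z ^ d) =O[𝓝 0] fun z => ‖z‖ ^ (d + 1) := by
  obtain ⟨L, A, hL, hA, hlead⟩ := h.sub_isLittleO hu₁ h0 hv hw hΦ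
  have hT : Tendsto (fun x : ℝ => (x : ℂ)) (𝓝[>] 0) (𝓝[{w : ℂ | 0 ≤ σ * w.im}] 0) :=
    tendsto_nhdsWithin_iff.2 ⟨tendsto_ofReal_nhdsGT, Eventually.of_forall fun x => by simp⟩
  have hpow : ∀ m n : ℕ, m < n → (fun x : ℝ => x ^ n) =o[𝓝[>] 0] fun x : ℝ => x ^ m :=
    fun m n hmn => IsLittleO.mono (isLittleO_pow_pow hmn) nhdsWithin_le_nhds
  have hd' := hd.mono (nhdsWithin_le_nhds (s := Set.Ioi (0 : ℝ)))
  -- Vanishing of `Φ ∘ w` beyond order `d` would give `φ = o(x ^ d)` on the positive axis, against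
  -- `r ≠ 0`. A leading term of degree `m < d` would give `φ` a nonzero term in `x ^ m`.
  rcases (hΦ.holJet w (hw.holJet_comp hu₂)).isBigO_or (d + 1) with hE | ⟨m, hm, c, hc, hE⟩
  · refine absurd (eq_zero_of_isLittleO (m := d) ?_) hr
    have h1 := isLittleO_norm_ofReal
      ((hlead d 0 (Nat.lt_succ_self d) (by simpa using hE)).comp_tendsto hT)
    refine (h1.sub (hd'.trans_isLittleO (hpow _ _ (Nat.lt_succ_self d)))).congr_left fun x => ?_
    simp
  · rcases (Nat.lt_succ_iff.1 hm).lt_or_eq with hlt | rfl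
    · exfalso
      have h1 := isLittleO_norm_ofReal ((hlead m c hm hE).comp_tendsto hT)
      have hσ0 : (σ : ℂ) ≠ 0 := fun h2 => by
        have := sign_mul_self h.1
        rw [h2, zero_mul] at this
        exact zero_ne_one this
      have hA0 : A 1 ≠ 0 := fun h2 => by
        have := hA.re_one
        rw [h2] at this
        exact lt_irrefl _ this
      have hLap : ∀ x : ℝ, L (c * σ ^ m * A x ^ m) = L (c * σ ^ m * A 1 ^ m) * (x : ℂ) ^ m :=
        fun x => by
          have h2 : A x = (x : ℂ) * A 1 := by
            have h3 : (x : ℂ) = x • (1 : ℂ) := by simp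
            conv_lhs => rw [h3]
            rw [map_smul, Complex.real_smul]
          have h4 : c * σ ^ m * A x ^ m = (x ^ m : ℝ) • (c * σ ^ m * A 1 ^ m) := by
            rw [h2, Complex.real_smul]
            push_cast
            ring
          rw [h4, map_smul, Complex.real_smul, Complex.ofReal_pow, mul_comm]
      have h2 : L (c * σ ^ m * A 1 ^ m) = 0 := by
        refine eq_zero_of_isLittleO (m := m) ?_
        have h3 : (fun x : ℝ => r * (x : ℂ) ^ d) =o[𝓝[>] 0] fun x : ℝ => x ^ m :=
          (IsBigO.of_bound ‖r‖ (Eventually.of_forall fun x => by simp)).trans_isLittleO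
            (hpow _ _ hlt)
        refine (((hd'.trans_isLittleO (hpow _ _ (hlt.trans (Nat.lt_succ_self d)))).add h3).sub
          h1).congr_left fun x => ?_
        simp only [Function.comp_apply, hLap]
        ring
      obtain ⟨K, -, hK⟩ := exists_norm_le_mul_of_det_ne_zero hL.ne'
      have h3 := hK (c * σ ^ m * A 1 ^ m)
      rw [h2, norm_zero, mul_zero] at h3
      exact mul_ne_zero (mul_ne_zero hc (pow_ne_zero _ hσ0)) (pow_ne_zero _ hA0)
        (norm_le_zero_iff.1 h3)
    · exact ⟨c, hc, hE⟩

theorem IsGraphForm.hasLocalIndex {d : ℕ} (hu₁ : IsAnalyticHalfDisk u₁) (h0 : u₁ 0 = u₂ 0)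
    (hv : IsSmoothExtensionAt u₁ v 0) (hw : IsSmoothExtensionAt u₂ w 0)
    (hΦ : IsDefiningFunction v (d + 1) Φ μ ℓ) {c : ℂ} (hc : c ≠ 0)
    (hE : (fun z => Φ (w z) - c * z ^ d) =O[𝓝 0] fun z => ‖z‖ ^ (d + 1))
    (h : IsGraphForm u₁ u₂ σ φ) (hreal : ∀ᶠ x : ℝ in 𝓝 0, (φ x).im = 0) :
    HasLocalIndex (reflect σ φ) d := by
  obtain ⟨L, A, hL, hA, hlead⟩ := h.sub_isLittleO hu₁ h0 hv hw hΦ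
  have hσ : σ ≠ 0 := by rcases h.1 with rfl | rfl <;> simp
  exact hasLocalIndex_reflect hσ (h.eventually_continuousWithinAt h0) (h.zero h0) hL hA
    (mul_ne_zero hc (pow_ne_zero d (by exact_mod_cast hσ))) (hlead d c (Nat.lt_succ_self d) hE) hreal

theorem IsSmoothExtensionAt.mem_tangentPlane (hu : IsAnalyticHalfDisk u)
    (hv : IsSmoothExtensionAt u v 0) {q : ℂ × ℂ} :
    q ∈ tangentPlane u ↔ ∃ z : ℂ, z • fderiv ℝ v 0 1 = q := by
  rw [tangentPlane, hv.fderivWithin_eq]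
  simp only [LinearMap.mem_range, ContinuousLinearMap.coe_coe]
  exact exists_congr fun z => by rw [hv.fderiv_apply hu z]

theorem IsDefiningFunction.eq_smul_of_normal_eq_zero (hΦ : IsDefiningFunction v N Φ μ ℓ) {q : ℂ × ℂ}
    (hq : μ q = 0) : ℓ q • fderiv ℝ v 0 1 = q := by
  refine (sub_eq_zero.1 (hΦ.injective (q - ℓ q • fderiv ℝ v 0 1) ?_ ?_)).symm
  · simp [hΦ.tangent]
  · simp [hq, hΦ.normal]

/-- Both tangent planes are complex lines and the first is the kernel of `μ`. They span `ℂ²` exactly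
when `μ` is nonzero on the second. -/
theorem intersectTransversely_iff (hu₁ : IsAnalyticHalfDisk u₁) (hu₂ : IsAnalyticHalfDisk u₂)
    (hv : IsSmoothExtensionAt u₁ v 0) (hw : IsSmoothExtensionAt u₂ w 0)
    (hΦ : IsDefiningFunction v N Φ μ ℓ) :
    IntersectTransversely u₁ u₂ ↔ μ (fderiv ℝ w 0 1) ≠ 0 := by
  unfold IntersectTransversely
  constructor
  · intro h hb
    have hμ : ∀ q, μ q = 0 := fun q => by
      have hq : q ∈ tangentPlane u₁ ⊔ tangentPlane u₂ := h ▸ Submodule.mem_top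
      obtain ⟨x, hx, y, hy, rfl⟩ := Submodule.mem_sup.1 hq
      obtain ⟨s, rfl⟩ := (hv.mem_tangentPlane hu₁).1 hx
      obtain ⟨t, rfl⟩ := (hw.mem_tangentPlane hu₂).1 hy
      simp [hb, hΦ.normal]
    have h1 := hΦ.eq_smul_of_normal_eq_zero (hμ (1, 0))
    have h2 := hΦ.eq_smul_of_normal_eq_zero (hμ (0, 1))
    have h11 : ℓ (1, 0) * (fderiv ℝ v 0 1).1 = 1 := congrArg Prod.fst h1
    have h12 : ℓ (1, 0) * (fderiv ℝ v 0 1).2 = 0 := congrArg Prod.snd h1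
    have h22 : ℓ (0, 1) * (fderiv ℝ v 0 1).2 = 1 := congrArg Prod.snd h2
    rcases mul_eq_zero.1 h12 with h3 | h3
    · simp [h3] at h11
    · simp [h3] at h22
  · intro hb
    refine eq_top_iff.2 fun q _ => Submodule.mem_sup.2 ?_
    set t := μ q / μ (fderiv ℝ w 0 1) with ht
    refine ⟨q - t • fderiv ℝ w 0 1, (hv.mem_tangentPlane hu₁).2 ⟨_, hΦ.eq_smul_of_normal_eq_zero ?_⟩,
      t • fderiv ℝ w 0 1, (hw.mem_tangentPlane hu₂).2 ⟨t, rfl⟩, sub_add_cancel _ _⟩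
    rw [map_sub, map_smul, smul_eq_mul, ht, div_mul_cancel₀ _ hb, sub_self]

theorem normal_fderiv_eq (hw : DifferentiableAt ℝ w 0) (hΦ : HasStrictFDerivAt Φ μ (w 0)) {b : ℂ}
    (hE : (fun z => Φ (w z) - b * z) =O[𝓝 0] fun z => ‖z‖ ^ 2) : μ (fderiv ℝ w 0 1) = b := by
  have h1 := (hΦ.hasFDerivAt.restrictScalars ℝ).comp 0 hw.hasFDerivAt
  have h0 : Φ (w 0) = 0 := by
    obtain ⟨B, hB⟩ := hE.bound
    simpa using hB.self_of_nhds
  have h2 : HasFDerivAt (fun z => Φ (w z))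
      ((ContinuousLinearMap.mul ℂ ℂ b).restrictScalars ℝ) 0 := by
    refine .of_isLittleO ?_
    have h3 := hE.trans_isLittleO (isLittleO_norm_pow_succ (E := ℂ) 1 le_rfl)
    simp only [pow_one] at h3
    exact h3.of_norm_right.congr (fun z => by simp [h0]) fun z => by simp
  have h3 := congrArg (fun T : ℂ →L[ℝ] ℂ => T 1) (h1.unique h2)
  simpa using h3

end

end HalfDisk

/-! ### The theorem -/

theorem theorem2 (u₁ u₂ : ℂ → ℂ × ℂ)
    (hu₁ : HalfDisk.IsAnalyticHalfDisk u₁) (hu₂ : HalfDisk.IsAnalyticHalfDisk u₂)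
    (h0 : u₁ 0 = u₂ 0) (d : ℕ) (hd : HalfDisk.HasTangencyOrder u₁ u₂ d) :
    (∀ k : ℤ, HalfDisk.IsIntersectionIndex u₁ u₂ k ↔ k = d) ∧ 0 < d ∧
      ∀ k : ℤ, HalfDisk.IsIntersectionIndex u₁ u₂ k →
        (k = 1 ↔ HalfDisk.IntersectTransversely u₁ u₂) := by
  obtain ⟨σ, φ, hgf, r, hr, hO⟩ := hd
  have hdpos : 0 < d := by
    -- For `d = 0` the estimate at `x = 0` would read `‖φ 0 - r‖ ≤ 0`, while `φ 0 = 0` and `r ≠ 0`.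
    rcases Nat.eq_zero_or_pos d with rfl | h
    · obtain ⟨B, hB⟩ := hO.bound
      have h1 := hB.self_of_nhds
      simp [hgf.zero h0, hr] at h1
    · exact h
  obtain ⟨v, hv⟩ := hu₁.smooth 0 HalfDisk.zero_mem_upperHalfDisk
  obtain ⟨w, hw⟩ := hu₂.smooth 0 HalfDisk.zero_mem_upperHalfDisk
  obtain ⟨Φ, μ, ℓ, hΦ⟩ := HalfDisk.exists_isDefiningFunction hv.1.differentiableAt
    (hv.holJet_comp hu₁) (hv.fderiv_apply hu₁) (hv.fderiv_ne_zero hu₁) (Nat.succ_le_succ hdpos)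
  obtain ⟨c, hc, hE⟩ :=
    HalfDisk.exists_sub_isBigO_of_tangency hu₁ hu₂ h0 hv hw hΦ hgf hr hO
  have hindex : ∀ k : ℤ, HalfDisk.IsIntersectionIndex u₁ u₂ k ↔ k = d := fun k => by
    refine ⟨?_, ?_⟩
    · rintro ⟨τ, ψ, hψ, hreal, hk⟩
      exact hk.unique (hψ.hasLocalIndex hu₁ h0 hv hw hΦ hc hE hreal)
    · rintro rfl
      obtain ⟨ψ, hψ, hreal⟩ := hgf.exists_real h0 hr hO
      exact ⟨σ, ψ, hψ, hreal, hψ.hasLocalIndex hu₁ h0 hv hw hΦ hc hE hreal⟩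
  refine ⟨hindex, hdpos, fun k hk => ?_⟩
  have hΦw : HasStrictFDerivAt Φ μ (w 0) := by
    rw [hw.eq_zero, ← h0, ← hv.eq_zero]
    exact hΦ.strict
  rw [(hindex k).1 hk, HalfDisk.intersectTransversely_iff hu₁ hu₂ hv hw hΦ]
  -- The value of `μ` on the tangent of `C₂` is the linear coefficient of `Φ ∘ w`: it is `c` if `d =
  -- 1` and `0` if `d ≥ 2`.
  rcases (Nat.succ_le_iff.2 hdpos).eq_or_lt with rfl | h2
  · have h1 := HalfDisk.normal_fderiv_eq hw.1.differentiableAt hΦw (b := c) (by simpa using hE)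
    simp [h1, hc]
  · have h3 : (fun z => Φ (w z)) =O[𝓝 0] fun z => ‖z‖ ^ 2 := by
      have h4 : (fun z : ℂ => c * z ^ d) =O[𝓝 0] fun z : ℂ => ‖z‖ ^ d :=
        Asymptotics.IsBigO.of_bound ‖c‖ (Eventually.of_forall fun z => by simp)
      refine ((hE.trans (HalfDisk.isBigO_norm_pow_of_le (E := ℂ) (by omega))).add
        (h4.trans (HalfDisk.isBigO_norm_pow_of_le (E := ℂ) h2))).congr_left fun z => by ring
    have h1 := HalfDisk.normal_fderiv_eq hw.1.differentiableAt hΦw (b := 0) (by simpa using h3)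
    rw [h1]
    have h4 : (d : ℤ) ≠ 1 := by
      have h5 : 1 < d := h2
      omega
    simp [h4]
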